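/- Let $L$ be an odd positive integer. For $\theta\in\mathbb{R}^L$ write $\hat\theta_j=\frac1{\sqrt L}\sum_{k=1}^{L}e^{2\pi i jk/L}\theta_k$ for $|j|\le\lfloor L/2\rfloor$, and $\operatorname{supp}(\hat\theta)=\{j\in\{1,\dots,\lfloor L/2\rfloor\}:\hat\theta_j\neq0\}$. For $z\in\mathbb{C}$ with $|z|=1$ let $G_z$ be the linear map of $\mathbb{R}^L$ determined by $\widehat{(G_z\theta)}_j=z^j\hat\theta_j$ for $|j|\le\lfloor L/2\rfloor$, and set $\rho(\theta,\phi)=\min_{|z|=1}\|\theta-G_z\phi\|$, where $\|\cdot\|$ is the Euclidean norm. For $\sigma>0$ let $\mathrm{P}_\theta$ be the law of $Y=G_z\theta+\sigma\xi$, where $z$ is uniform on the unit circle and $\xi\sim\mathcal N(0,I_L)$ is independent of $z$, and let $D(\theta\,\|\,\phi)$ be the Kullback--Leibler divergence of $\mathrm{P}_\theta$ from $\mathrm{P}_\phi$, that is, $\int\log\frac{d\mathrm{P}_\theta}{d\mathrm{P}_\phi}\,d\mathrm{P}_\theta$. For $S\subseteq\{1,\dots,\lfloor L/2\rfloor\}$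 let $P_S$ be the projection of $\mathbb{R}^L$ that keeps the Fourier coefficients with index in $S\cup(-S)\cup\{0\}$ and sets the others to $0$. Given $c>1$ and $c_0>0$, let $\mathcal T_s$ be the set of $\theta\in\mathbb{R}^L$ such that $c^{-1}\le\|\theta\|\le c$, $|\hat\theta_j|\ge c_0$ for all $j\in\operatorname{supp}(\hat\theta)$, and $\operatorname{supp}(\hat\theta)\subseteq\{1,\dots,s\}$. Proposition. Let $L$ be odd, $c>1$ and $c_0>0$. There is a constant $C>0$, depending only on $L$, $c$ and $c_0$, such that for every integer $s$ with $2\le s\le\lfloor L/2\rfloor$, every $\theta\in\mathcal T_s$ with $S=\operatorname{supp}(\hat\theta)$, every $\phi$ in the image of $P_S$, and every $\sigma\ge\|\theta\|$, $$D(\theta\,\|\,\phi)\;\ge\;C\,\sigma^{-4s+2}\,\rho^2(\theta,\phi).$$ -/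

import Mathlib

open MeasureTheory ProbabilityTheory

noncomputable section

namespace PhaseShift

variable {L : ℕ}

/-- The discrete Fourier transform `θ̂_j = L^{-1/2} ∑_{k=1}^L e^{2πijk/L} θ_k` of a real signal.
The coordinate `θ_k`, `1 ≤ k ≤ L`, is stored at the index `k - 1` of `Fin L`. -/
def dft (θ : EuclideanSpace ℝ (Fin L)) (j : ℤ) : ℂ :=
  (1 / (Real.sqrt L : ℂ)) *
    ∑ k : Fin L, Complex.exp (2 * Real.pi * Complex.I * j * ((k : ℕ) + 1) / L) * (θ k : ℂ)

/-- The signal `θ_k = L^{-1/2} ∑_{|j| ≤ ⌊L/2⌋} e^{-2πijk/L} a_j` with prescribed Fourier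
coefficients `a_j`, `|j| ≤ ⌊L/2⌋`. For conjugate symmetric `a` and odd `L` (the only case of
interest) the sum is real and `dft_invDft` below shows that its Fourier coefficients are `a`. -/
def invDft (a : ℤ → ℂ) : EuclideanSpace ℝ (Fin L) :=
  WithLp.toLp 2 fun k : Fin L =>
    ((1 / (Real.sqrt L : ℂ)) *
      ∑ j ∈ Finset.Icc (-((L / 2 : ℕ) : ℤ)) ((L / 2 : ℕ) : ℤ),
        Complex.exp (-(2 * Real.pi * Complex.I * j * ((k : ℕ) + 1) / L)) * a j).re

/-- The phase shift `G_z`, determined by `(G_z θ)^_j = z^j θ̂_j` for `|j| ≤ ⌊L/2⌋`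
(see `dft_phaseShift`). -/
def phaseShift (z : Circle) (θ : EuclideanSpace ℝ (Fin L)) : EuclideanSpace ℝ (Fin L) :=
  invDft fun j => (z : ℂ) ^ j * dft θ j

/-- The distance `ρ(θ, φ) = min_{|z| = 1} ‖θ - G_z φ‖` between `θ` and the orbit of `φ`. -/
def orbitDist (θ φ : EuclideanSpace ℝ (Fin L)) : ℝ :=
  ⨅ z : Circle, ‖θ - phaseShift z φ‖

/-- The law `P_θ` of `Y = G_z θ + σ ξ` in the phase shift model, where `z = e^{-2πis}` with `s`
uniform on `[0, 1]` (so that `z` is uniform on the unit circle), and `ξ` is a standard Gaussian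
vector that is independent of `z`. -/
def signalLaw (σ : ℝ) (θ : EuclideanSpace ℝ (Fin L)) : Measure (EuclideanSpace ℝ (Fin L)) :=
  Measure.map
    (fun p : ℝ × EuclideanSpace ℝ (Fin L) =>
      phaseShift (Circle.exp (-(2 * Real.pi * p.1))) θ + σ • p.2)
    ((volume.restrict (Set.Icc (0 : ℝ) 1)).prod (stdGaussian (EuclideanSpace ℝ (Fin L))))

/-- The Kullback-Leibler divergence `D(θ ‖ φ) = D(P_θ ‖ P_φ)` at noise level `σ`. -/
def divergence (σ : ℝ) (θ φ : EuclideanSpace ℝ (Fin L)) : ℝ :=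
  (InformationTheory.klDiv (signalLaw σ θ) (signalLaw σ φ)).toReal

/-- The positive support `{j | 1 ≤ j ≤ L/2, θ̂_j ≠ 0}` of `θ̂`. -/
def posSupp (θ : EuclideanSpace ℝ (Fin L)) : Set ℕ :=
  {j | 1 ≤ j ∧ j ≤ L / 2 ∧ dft θ j ≠ 0}

/-- The signals with `c⁻¹ ≤ ‖θ‖ ≤ c` whose Fourier coefficients on the positive support have
modulus at least `c₀`, and whose positive support is contained in `{1, …, s}`. -/
def signalClass (L : ℕ) (c c₀ : ℝ) (s : ℕ) : Set (EuclideanSpace ℝ (Fin L)) :=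
  {θ | c⁻¹ ≤ ‖θ‖ ∧ ‖θ‖ ≤ c ∧ (∀ j ∈ posSupp θ, c₀ ≤ ‖dft θ j‖) ∧ posSupp θ ⊆ Set.Icc 1 s}

open Classical in
/-- The projection `P_S`, which keeps the Fourier coefficients with index in `S ∪ -S ∪ {0}` and
sets the others to zero (see `dft_suppProj`). -/
def suppProj (S : Set ℕ) (φ : EuclideanSpace ℝ (Fin L)) : EuclideanSpace ℝ (Fin L) :=
  invDft fun j => if j = 0 ∨ j.natAbs ∈ S then dft φ j else 0

/-- The Fourier transform of a real signal is conjugate symmetric. -/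
theorem dft_neg (θ : EuclideanSpace ℝ (Fin L)) (j : ℤ) :
    dft θ (-j) = starRingEnd ℂ (dft θ j) := by
  unfold dft
  simp only [map_mul, map_sum, map_div₀, map_one, Complex.conj_ofReal, ← Complex.exp_conj,
    Complex.conj_I, map_natCast, map_intCast, map_add, map_ofNat]
  congr 1
  refine Finset.sum_congr rfl fun k _ => ?_
  congr 2
  push_cast
  ring

theorem sum_exp_eq (hL : L ≠ 0) (d : ℤ) (hd : |d| < L) :
    ∑ k : Fin L, Complex.exp (2 * Real.pi * Complex.I * d * ((k : ℕ) + 1) / L) =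
      if d = 0 then (L : ℂ) else 0 := by
  split_ifs with h
  · simp [h]
  · have hL' : (L : ℂ) ≠ 0 := by exact_mod_cast hL
    set w : ℂ := Complex.exp (2 * Real.pi * Complex.I * d / L) with hw
    have hterm : ∀ k : ℕ, Complex.exp (2 * Real.pi * Complex.I * d * ((k : ℕ) + 1) / L)
        = w * w ^ k := by
      intro k
      rw [hw, ← Complex.exp_nat_mul, ← Complex.exp_add]
      congr 1
      ring
    have hw1 : w ≠ 1 := by
      intro hw1
      rw [hw, Complex.exp_eq_one_iff] at hw1
      obtain ⟨n, hn⟩ := hw1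
      have h2 : (2 * Real.pi * Complex.I : ℂ) ≠ 0 := by
        simp [Real.pi_ne_zero, Complex.I_ne_zero]
      have h3 : (d : ℂ) = n * L := by
        field_simp at hn
        have := mul_left_cancel₀ h2 (a := (2 * Real.pi * Complex.I : ℂ)) (b := (d : ℂ))
          (c := n * L) (by linear_combination (2 * Real.pi * Complex.I) * hn)
        exact this
      have h4 : d = n * L := by exact_mod_cast h3
      have h5 : (L : ℤ) ∣ d := ⟨n, by rw [h4]; ring⟩
      exact h (Int.eq_zero_of_abs_lt_dvd h5 hd)
    have hwL : w ^ L = 1 := by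
      rw [hw, ← Complex.exp_nat_mul, Complex.exp_eq_one_iff]
      exact ⟨d, by field_simp⟩
    have : ∑ k : Fin L, Complex.exp (2 * Real.pi * Complex.I * d * ((k : ℕ) + 1) / L)
        = ∑ k ∈ Finset.range L, w * w ^ k := by
      rw [← Fin.sum_univ_eq_sum_range (fun k => w * w ^ k)]
      exact Finset.sum_congr rfl fun k _ => hterm k
    rw [this, ← Finset.mul_sum, geom_sum_eq hw1, hwL]
    simp

/-- `invDft` inverts the Fourier transform: for odd `L`, any conjugate symmetric family of
coefficients is the family of Fourier coefficients of the real signal `invDft a`. -/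
theorem dft_invDft (hL : Odd L) (a : ℤ → ℂ) (ha : ∀ j, a (-j) = starRingEnd ℂ (a j))
    (j : ℤ) (hj : |j| ≤ ((L / 2 : ℕ) : ℤ)) :
    dft (invDft a : EuclideanSpace ℝ (Fin L)) j = a j := by
  have hL0 : L ≠ 0 := by rintro rfl; simp at hL
  have hL' : (L : ℂ) ≠ 0 := by exact_mod_cast hL0
  set I := Finset.Icc (-((L / 2 : ℕ) : ℤ)) ((L / 2 : ℕ) : ℤ) with hI
  have hreal : ∀ k : Fin L, (((invDft a : EuclideanSpace ℝ (Fin L)) k : ℝ) : ℂ) =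
      (1 / (Real.sqrt L : ℂ)) * ∑ i ∈ I,
        Complex.exp (-(2 * Real.pi * Complex.I * i * ((k : ℕ) + 1) / L)) * a i := by
    intro k
    refine Complex.conj_eq_iff_re.mp ?_
    simp only [map_mul, map_sum, map_div₀, map_one, Complex.conj_ofReal, ← Complex.exp_conj,
      Complex.conj_I, map_natCast, map_intCast, map_add, map_ofNat, map_neg, ← ha]
    congr 1
    refine Finset.sum_nbij' (fun i => -i) (fun i => -i) ?_ ?_ ?_ ?_ ?_
    · intro i hi; simp only [Finset.mem_Icc] at hi ⊢; omega
    · intro i hi; simp only [Finset.mem_Icc] at hi ⊢; omega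
    · intro i _; simp
    · intro i _; simp
    · intro i _
      congr 2
      push_cast
      ring
  unfold dft
  simp only [hreal]
  have hs : (1 / (Real.sqrt L : ℂ)) * (1 / (Real.sqrt L : ℂ)) = 1 / (L : ℂ) := by
    rw [div_mul_div_comm, one_mul, ← Complex.ofReal_mul, Real.mul_self_sqrt (Nat.cast_nonneg L)]
    simp
  have hswap : ∑ k : Fin L, Complex.exp (2 * Real.pi * Complex.I * j * ((k : ℕ) + 1) / L) *
      ((1 / (Real.sqrt L : ℂ)) * ∑ i ∈ I,
        Complex.exp (-(2 * Real.pi * Complex.I * i * ((k : ℕ) + 1) / L)) * a i) =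
      (1 / (Real.sqrt L : ℂ)) * ∑ i ∈ I, (if j - i = 0 then (L : ℂ) else 0) * a i := by
    simp only [Finset.mul_sum]
    rw [Finset.sum_comm]
    refine Finset.sum_congr rfl fun i hi => ?_
    have hd : |j - i| < L := by
      simp only [hI, Finset.mem_Icc] at hi
      obtain ⟨m, hm⟩ := hL
      rw [abs_le] at hj
      rw [abs_lt]
      omega
    rw [← sum_exp_eq hL0 (j - i) hd, Finset.sum_mul, Finset.mul_sum]
    refine Finset.sum_congr rfl fun k _ => ?_
    have : Complex.exp (2 * Real.pi * Complex.I * ((j - i : ℤ) : ℂ) * ((k : ℕ) + 1) / L) =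
        Complex.exp (2 * Real.pi * Complex.I * j * ((k : ℕ) + 1) / L) *
        Complex.exp (-(2 * Real.pi * Complex.I * i * ((k : ℕ) + 1) / L)) := by
      rw [← Complex.exp_add]
      congr 1
      push_cast
      ring
    rw [this]
    ring
  rw [hswap, ← mul_assoc, hs]
  have hjI : j ∈ I := by
    rw [hI, Finset.mem_Icc]
    exact abs_le.mp hj
  rw [Finset.sum_eq_single j]
  · simp only [sub_self, if_true]
    field_simp
  · intro i _ hij
    rw [if_neg (sub_ne_zero.mpr (Ne.symm hij)), zero_mul]
  · exact fun h => absurd hjI h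

theorem dft_phaseShift (hL : Odd L) (z : Circle) (θ : EuclideanSpace ℝ (Fin L)) (j : ℤ)
    (hj : |j| ≤ ((L / 2 : ℕ) : ℤ)) :
    dft (phaseShift z θ) j = (z : ℂ) ^ j * dft θ j := by
  refine dft_invDft hL _ (fun i => ?_) j hj
  rw [dft_neg, map_mul, map_zpow₀, ← Circle.coe_inv_eq_conj, zpow_neg, Circle.coe_inv, inv_zpow]

open Classical in
theorem dft_suppProj (hL : Odd L) (S : Set ℕ) (φ : EuclideanSpace ℝ (Fin L)) (j : ℤ)
    (hj : |j| ≤ ((L / 2 : ℕ) : ℤ)) :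
    dft (suppProj S φ) j = if j = 0 ∨ j.natAbs ∈ S then dft φ j else 0 := by
  refine dft_invDft hL _ (fun i => ?_) j hj
  by_cases h : i = 0 ∨ i.natAbs ∈ S
  · simp [h, dft_neg]
  · simp [h]

end PhaseShift

end

/-! The divergence D is bounded below by testing both laws against polynomials. A Cauchy–Schwarz
type inequality, `norm_integral_sub_integral_sq_le`, gives |E_θ h − E_φ h|² ≤ 2 (E_θ|h|² + E_φ|h|²)
D. Take for h a monomial in the Fourier coefficients of Y at unit noise. Expanding signal plus noise
and inducting on the set of factors bounds the differences of the moments of the shifted signal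
alone by a constant times √D (`exists_norm_moment_sub_le`). When the frequencies sum to zero the
monomial is shift invariant, so its moment is its value at the signal.

Three families of invariants determine the orbit quantitatively: θ̂_0, |θ̂_j|², and θ̂_j^(k/d)
conj(θ̂_k)^(j/d) for distinct j, k in S, with d = gcd S. The second family controls moduli. The
third gives approximate relations between phases, from which Bézout coefficients build a single
shift z (`exists_forall_norm_sub_pow_le`, `exists_forall_orbitDist_le`). Distinct j, k in {1, …, s}
give degree at most 2s − 1, so rescaling to unit noise yields ρ ≲ σ^(2s−1) √D, and squaring produces
the exponent −4s + 2.

The moment constants require ‖θ‖, ‖φ‖ ≤ Kσ. For larger φ, `exists_forall_sq_norm_le_divergence`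
bounds D below by a multiple of ‖φ‖²/σ² directly. -/

noncomputable section

namespace PhaseShift

/-! ### Fourier analysis on the signal space and phase shifts. -/

section Fourier

variable {L : ℕ}

/-- Orthogonality dual to `sum_exp_eq`, needed for Parseval. For odd L the symmetric window is a
full period, so an index shift only costs a unimodular factor. -/
theorem sum_Icc_exp_eq (hL : Odd L) (d : ℤ) (hd : |d| < L) :
    ∑ j ∈ Finset.Icc (-((L / 2 : ℕ) : ℤ)) ((L / 2 : ℕ) : ℤ),
      Complex.exp (2 * Real.pi * Complex.I * j * d / L) = if d = 0 then (L : ℂ) else 0 := by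
  have hL0 : L ≠ 0 := by rintro rfl; simp at hL
  set m : ℕ := L / 2 with hm
  have hLm : L = 2 * m + 1 := by obtain ⟨n, hn⟩ := hL; omega
  have h1 : ∑ j ∈ Finset.Icc (-(m : ℤ)) (m : ℤ),
      Complex.exp (2 * Real.pi * Complex.I * j * d / L) =
      ∑ k ∈ Finset.range L, Complex.exp (2 * Real.pi * Complex.I * (-(m : ℂ) - 1) * d / L) *
        Complex.exp (2 * Real.pi * Complex.I * d * ((k : ℕ) + 1) / L) := by
    refine Finset.sum_nbij' (fun j => (j + m).toNat) (fun k => (k : ℤ) - m) ?_ ?_ ?_ ?_ ?_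
    · intro j hj; simp only [Finset.mem_Icc, Finset.mem_range] at hj ⊢; omega
    · intro j hj; simp only [Finset.mem_Icc, Finset.mem_range] at hj ⊢; omega
    · intro j hj; simp only [Finset.mem_Icc] at hj ⊢; omega
    · intro j hj; simp only [Finset.mem_range] at hj ⊢; omega
    · intro j hj
      simp only [Finset.mem_Icc] at hj
      have h2 : (((j + m).toNat : ℕ) : ℂ) = (j : ℂ) + m := by
        have : (((j + m).toNat : ℕ) : ℤ) = j + m := by omega
        exact_mod_cast congrArg (Int.cast (R := ℂ)) this
      rw [h2, ← Complex.exp_add]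
      congr 1
      ring
  rw [h1, ← Finset.mul_sum,
    ← Fin.sum_univ_eq_sum_range
      (fun k => Complex.exp (2 * Real.pi * Complex.I * d * ((k : ℕ) + 1) / L)),
    sum_exp_eq hL0 d hd]
  split_ifs with h <;> simp [h]

/-- Parseval's identity. -/
theorem norm_sq_eq_sum_dft (hL : Odd L) (θ : EuclideanSpace ℝ (Fin L)) :
    ‖θ‖ ^ 2 = ∑ j ∈ Finset.Icc (-((L / 2 : ℕ) : ℤ)) ((L / 2 : ℕ) : ℤ), ‖dft θ j‖ ^ 2 := by
  have hL0 : L ≠ 0 := by rintro rfl; simp at hL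
  have hL' : (L : ℂ) ≠ 0 := by exact_mod_cast hL0
  set I := Finset.Icc (-((L / 2 : ℕ) : ℤ)) ((L / 2 : ℕ) : ℤ) with hI
  have hs : (1 / (Real.sqrt L : ℂ)) * (1 / (Real.sqrt L : ℂ)) = 1 / (L : ℂ) := by
    rw [div_mul_div_comm, one_mul, ← Complex.ofReal_mul, Real.mul_self_sqrt (Nat.cast_nonneg L)]
    simp
  have key : ∑ j ∈ I, dft θ j * dft θ (-j) = ∑ k : Fin L, (θ k : ℂ) * θ k := by
    have h1 : ∀ j ∈ I, dft θ j * dft θ (-j) = ∑ k : Fin L, ∑ l : Fin L,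
        (1 / (L : ℂ)) * ((θ k : ℂ) * θ l) *
          Complex.exp (2 * Real.pi * Complex.I * j * (((k : ℕ) : ℤ) - ((l : ℕ) : ℤ) : ℤ) / L) := by
      intro j _
      unfold dft
      rw [mul_mul_mul_comm, hs, Finset.sum_mul_sum, Finset.mul_sum]
      refine Finset.sum_congr rfl fun k _ => ?_
      rw [Finset.mul_sum]
      refine Finset.sum_congr rfl fun l _ => ?_
      rw [show (2 * Real.pi * Complex.I * j * (((k : ℕ) : ℤ) - ((l : ℕ) : ℤ) : ℤ) / L : ℂ) =
        2 * Real.pi * Complex.I * j * ((k : ℕ) + 1) / L +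
        2 * Real.pi * Complex.I * (-j : ℤ) * ((l : ℕ) + 1) / L by push_cast; ring, Complex.exp_add]
      ring
    rw [Finset.sum_congr rfl h1, Finset.sum_comm]
    refine Finset.sum_congr rfl fun k _ => ?_
    rw [Finset.sum_comm, Finset.sum_eq_single k]
    · rw [← Finset.mul_sum, sum_Icc_exp_eq hL _ (by simp; omega)]
      simp
      field_simp
    · intro l _ hl
      have hkl : ((k : ℕ) : ℤ) - ((l : ℕ) : ℤ) ≠ 0 := by
        intro h
        exact hl (Fin.ext (by omega))
      rw [← Finset.mul_sum, sum_Icc_exp_eq hL _ (by rw [abs_lt]; constructor <;> omega),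
        if_neg hkl, mul_zero]
    · simp
  have h2 : ((‖θ‖ ^ 2 : ℝ) : ℂ) = ((∑ j ∈ I, ‖dft θ j‖ ^ 2 : ℝ) : ℂ) := by
    rw [EuclideanSpace.real_norm_sq_eq]
    push_cast
    simp_rw [pow_two]
    rw [← key]
    refine Finset.sum_congr rfl fun j _ => ?_
    rw [dft_neg, Complex.mul_conj, Complex.normSq_eq_norm_sq]
    push_cast; ring
  exact_mod_cast h2

theorem dft_add (θ φ : EuclideanSpace ℝ (Fin L)) (j : ℤ) :
    dft (θ + φ) j = dft θ j + dft φ j := by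
  simp only [dft, PiLp.add_apply, Complex.ofReal_add, mul_add, Finset.sum_add_distrib]

theorem dft_smul (a : ℝ) (θ : EuclideanSpace ℝ (Fin L)) (j : ℤ) :
    dft (a • θ) j = a * dft θ j := by
  simp only [dft, PiLp.smul_apply, smul_eq_mul, Complex.ofReal_mul, Finset.mul_sum]
  refine Finset.sum_congr rfl fun k _ => by ring

theorem dft_sub (θ φ : EuclideanSpace ℝ (Fin L)) (j : ℤ) :
    dft (θ - φ) j = dft θ j - dft φ j := by
  rw [sub_eq_add_neg, dft_add, ← neg_one_smul ℝ φ, dft_smul]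
  push_cast; ring

theorem continuous_dft (j : ℤ) :
    Continuous fun θ : EuclideanSpace ℝ (Fin L) => dft θ j := by
  unfold dft
  fun_prop

theorem norm_dft_le (hL : Odd L) (θ : EuclideanSpace ℝ (Fin L)) {j : ℤ}
    (hj : |j| ≤ ((L / 2 : ℕ) : ℤ)) : ‖dft θ j‖ ≤ ‖θ‖ := by
  refine le_of_sq_le_sq ?_ (norm_nonneg _)
  rw [norm_sq_eq_sum_dft hL]
  exact Finset.single_le_sum (f := fun j => ‖dft θ j‖ ^ 2) (fun _ _ => by positivity)
    (Finset.mem_Icc.2 (abs_le.1 hj))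

theorem eq_of_dft_eq (hL : Odd L) {θ φ : EuclideanSpace ℝ (Fin L)}
    (h : ∀ j : ℤ, |j| ≤ ((L / 2 : ℕ) : ℤ) → dft θ j = dft φ j) : θ = φ := by
  have h1 : ‖θ - φ‖ ^ 2 = 0 := by
    rw [norm_sq_eq_sum_dft hL]
    refine Finset.sum_eq_zero fun j hj => ?_
    rw [dft_sub, h j (abs_le.2 (Finset.mem_Icc.1 hj))]
    simp
  exact sub_eq_zero.1 (norm_eq_zero.1 (pow_eq_zero_iff two_ne_zero |>.1 h1))

theorem norm_phaseShift (hL : Odd L) (z : Circle) (θ : EuclideanSpace ℝ (Fin L)) :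
    ‖phaseShift z θ‖ = ‖θ‖ := by
  refine (sq_eq_sq₀ (norm_nonneg _) (norm_nonneg _)).1 ?_
  rw [norm_sq_eq_sum_dft hL, norm_sq_eq_sum_dft hL]
  refine Finset.sum_congr rfl fun j hj => ?_
  rw [dft_phaseShift hL z θ j (abs_le.2 (Finset.mem_Icc.1 hj)), norm_mul, norm_zpow,
    Circle.norm_coe, one_zpow, one_mul]

theorem phaseShift_smul (hL : Odd L) (z : Circle) (a : ℝ) (θ : EuclideanSpace ℝ (Fin L)) :
    phaseShift z (a • θ) = a • phaseShift z θ := by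
  refine eq_of_dft_eq hL fun j hj => ?_
  rw [dft_phaseShift hL _ _ _ hj, dft_smul, dft_smul, dft_phaseShift hL _ _ _ hj]
  ring

theorem continuous_phaseShift (θ : EuclideanSpace ℝ (Fin L)) :
    Continuous fun z : Circle => phaseShift z θ := by
  unfold phaseShift invDft
  refine (PiLp.continuous_toLp 2 _).comp (continuous_pi fun k => ?_)
  refine Complex.continuous_re.comp (continuous_const.mul (continuous_finsetSum _ fun j _ => ?_))
  refine continuous_const.mul (Continuous.mul ?_ continuous_const)
  simp_rw [← Circle.coe_zpow]
  exact continuous_subtype_val.comp (continuous_zpow (G := Circle) j)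

/-- The phase shift by the point of the circle with argument `-2πs`. -/
def rot (s : ℝ) (θ : EuclideanSpace ℝ (Fin L)) : EuclideanSpace ℝ (Fin L) :=
  phaseShift (Circle.exp (-(2 * Real.pi * s))) θ

theorem continuous_rot (θ : EuclideanSpace ℝ (Fin L)) : Continuous fun s : ℝ => rot s θ :=
  (continuous_phaseShift θ).comp (by fun_prop)

theorem norm_rot (hL : Odd L) (s : ℝ) (θ : EuclideanSpace ℝ (Fin L)) : ‖rot s θ‖ = ‖θ‖ :=
  norm_phaseShift hL _ θ

theorem orbitDist_le (θ φ : EuclideanSpace ℝ (Fin L)) (z : Circle) :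
    orbitDist θ φ ≤ ‖θ - phaseShift z φ‖ :=
  ciInf_le ⟨0, by rintro _ ⟨z, rfl⟩; exact norm_nonneg _⟩ z

theorem orbitDist_nonneg (θ φ : EuclideanSpace ℝ (Fin L)) : 0 ≤ orbitDist θ φ :=
  Real.iInf_nonneg fun _ => norm_nonneg _

theorem norm_le_sum_dft (hL : Odd L) (θ : EuclideanSpace ℝ (Fin L)) :
    ‖θ‖ ≤ ∑ j ∈ Finset.Icc (-((L / 2 : ℕ) : ℤ)) ((L / 2 : ℕ) : ℤ), ‖dft θ j‖ := by
  refine le_of_sq_le_sq ?_ (Finset.sum_nonneg fun _ _ => norm_nonneg _)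
  rw [norm_sq_eq_sum_dft hL]
  exact Finset.sum_sq_le_sq_sum_of_nonneg fun _ _ => norm_nonneg _

end Fourier


/-! ### Divergence against differences of expectations. -/

section Divergence

/-- With u = √p and v = √q, log x ≤ x − 1 at x = v/u gives p log(p/q) + q − p ≥ (u − v)². The rest
is AM-GM for |u − v| and ta(u + v), and (u + v)² ≤ 2(u² + v²). The parameter t is kept so that
integration leaves a quadratic in t. -/
theorem two_mul_mul_abs_sub_le {p q : ℝ} (hp : 0 < p) (hq : 0 < q) (a t : ℝ) :
    2 * t * (a * |p - q|) ≤
      p * (Real.log p - Real.log q) + (q - p) + 2 * t ^ 2 * (a ^ 2 * p + a ^ 2 * q) := by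
  obtain ⟨u, hu, rfl⟩ : ∃ u, 0 < u ∧ u ^ 2 = p := ⟨√p, Real.sqrt_pos.2 hp, Real.sq_sqrt hp.le⟩
  obtain ⟨v, hv, rfl⟩ : ∃ v, 0 < v ∧ v ^ 2 = q := ⟨√q, Real.sqrt_pos.2 hq, Real.sq_sqrt hq.le⟩
  have h1 : Real.log (v / u) ≤ v / u - 1 := Real.log_le_sub_one_of_pos (by positivity)
  rw [Real.log_div hv.ne' hu.ne'] at h1
  have h2 : u ^ 2 * (Real.log v - Real.log u) ≤ u * v - u ^ 2 := by
    refine (mul_le_mul_of_nonneg_left h1 (by positivity)).trans (le_of_eq ?_)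
    field_simp
  rw [Real.log_pow, Real.log_pow, show u ^ 2 - v ^ 2 = (u - v) * (u + v) by ring, abs_mul,
    abs_of_pos (add_pos hu hv)]
  push_cast
  have h3 := sq_abs (u - v)
  nlinarith [sq_nonneg (|u - v| - t * a * (u + v)), sq_nonneg (t * a * (u - v))]

variable {α : Type*} {mα : MeasurableSpace α}

theorem integral_withDensity_ofReal {E : Type*} [NormedAddCommGroup E] [NormedSpace ℝ E]
    {γ : Measure α} {p : α → ℝ} (hp : Measurable p) (hp0 : ∀ x, 0 < p x) (f : α → E) :
    ∫ x, f x ∂(γ.withDensity fun x => ENNReal.ofReal (p x)) = ∫ x, p x • f x ∂γ := by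
  rw [integral_withDensity_eq_integral_toReal_smul hp.ennreal_ofReal (by simp)]
  simp_rw [ENNReal.toReal_ofReal (hp0 _).le]

theorem integrable_withDensity_ofReal {E : Type*} [NormedAddCommGroup E] [NormedSpace ℝ E]
    {γ : Measure α} {p : α → ℝ} (hp : Measurable p) (hp0 : ∀ x, 0 < p x) {f : α → E} :
    Integrable f (γ.withDensity fun x => ENNReal.ofReal (p x)) ↔
      Integrable (fun x => p x • f x) γ := by
  rw [integrable_withDensity_iff_integrable_smul' hp.ennreal_ofReal (by simp)]
  simp_rw [ENNReal.toReal_ofReal (hp0 _).le]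

theorem toReal_klDiv_withDensity {γ P Q : Measure α} [SigmaFinite γ]
    [IsProbabilityMeasure P] [IsProbabilityMeasure Q] {p q : α → ℝ}
    (hp : Measurable p) (hq : Measurable q) (hp0 : ∀ x, 0 < p x) (hq0 : ∀ x, 0 < q x)
    (hP : P = γ.withDensity fun x => ENNReal.ofReal (p x))
    (hQ : Q = γ.withDensity fun x => ENNReal.ofReal (q x)) :
    (InformationTheory.klDiv P Q).toReal = ∫ x, (Real.log (p x) - Real.log (q x)) ∂P := by
  have hPγ : P ≪ γ := hP ▸ withDensity_absolutelyContinuous _ _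
  have hγQ : γ ≪ Q := by
    rw [hQ]
    exact withDensity_absolutelyContinuous' hq.ennreal_ofReal.aemeasurable
      (.of_forall fun x => by simpa using hq0 x)
  rw [InformationTheory.toReal_klDiv_of_measure_eq (hPγ.trans hγQ) (by simp)]
  refine integral_congr_ae ?_
  have h1 : P.rnDeriv Q =ᵐ[γ] fun x => (ENNReal.ofReal (q x))⁻¹ * P.rnDeriv γ x := by
    rw [hQ]
    exact Measure.rnDeriv_withDensity_right P γ hq.ennreal_ofReal.aemeasurable
      (.of_forall fun x => by simpa using hq0 x) (.of_forall fun x => by simp)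
  have h2 : P.rnDeriv γ =ᵐ[γ] fun x => ENNReal.ofReal (p x) := by
    rw [hP]
    exact Measure.rnDeriv_withDensity γ hp.ennreal_ofReal
  filter_upwards [hPγ.ae_le h1, hPγ.ae_le h2] with x h1 h2
  rw [llr, h1, h2, ENNReal.toReal_mul, ENNReal.toReal_inv, ENNReal.toReal_ofReal (hq0 x).le,
    ENNReal.toReal_ofReal (hp0 x).le, Real.log_mul (inv_pos.2 (hq0 x)).ne' (hp0 x).ne',
    Real.log_inv]
  ring

/-- The difference of the expectations of a test function under two laws is controlled by their
Kullback-Leibler divergence and by the second moments of the test function. -/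
theorem norm_integral_sub_integral_sq_le {γ P Q : Measure α} [SigmaFinite γ]
    [IsProbabilityMeasure P] [IsProbabilityMeasure Q] {p q : α → ℝ}
    (hp : Measurable p) (hq : Measurable q) (hp0 : ∀ x, 0 < p x) (hq0 : ∀ x, 0 < q x)
    (hP : P = γ.withDensity fun x => ENNReal.ofReal (p x))
    (hQ : Q = γ.withDensity fun x => ENNReal.ofReal (q x))
    (hlog : Integrable (fun x => Real.log (p x) - Real.log (q x)) P)
    {h : α → ℂ} (hhP : Integrable h P) (hhQ : Integrable h Q)
    (hhP2 : Integrable (fun x => ‖h x‖ ^ 2) P) (hhQ2 : Integrable (fun x => ‖h x‖ ^ 2) Q) :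
    ‖∫ x, h x ∂P - ∫ x, h x ∂Q‖ ^ 2 ≤
      2 * (∫ x, ‖h x‖ ^ 2 ∂P + ∫ x, ‖h x‖ ^ 2 ∂Q) *
        (InformationTheory.klDiv P Q).toReal := by
  rw [toReal_klDiv_withDensity hp hq hp0 hq0 hP hQ]
  have hp1 : Integrable p γ := by
    have := integrable_const (μ := P) (1 : ℝ)
    rw [hP, integrable_withDensity_ofReal hp hp0] at this
    simpa using this
  have hq1 : Integrable q γ := by
    have := integrable_const (μ := Q) (1 : ℝ)
    rw [hQ, integrable_withDensity_ofReal hq hq0] at this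
    simpa using this
  have hpi : ∫ x, p x ∂γ = 1 := by
    have := integral_withDensity_ofReal (γ := γ) hp hp0 (fun _ => (1 : ℝ))
    rw [← hP] at this
    simpa using this.symm
  have hqi : ∫ x, q x ∂γ = 1 := by
    have := integral_withDensity_ofReal (γ := γ) hq hq0 (fun _ => (1 : ℝ))
    rw [← hQ] at this
    simpa using this.symm
  rw [hP, integrable_withDensity_ofReal hp hp0] at hhP hhP2 hlog
  rw [hQ, integrable_withDensity_ofReal hq hq0] at hhQ hhQ2
  rw [hP, hQ, integral_withDensity_ofReal hp hp0, integral_withDensity_ofReal hp hp0,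
    integral_withDensity_ofReal hp hp0, integral_withDensity_ofReal hq hq0,
    integral_withDensity_ofReal hq hq0, ← integral_sub hhP hhQ]
  set V := ∫ x, p x • ‖h x‖ ^ 2 ∂γ + ∫ x, q x • ‖h x‖ ^ 2 ∂γ with hV
  set D := ∫ x, p x • (Real.log (p x) - Real.log (q x)) ∂γ with hD
  have hdiff : ∀ x, ‖p x • h x - q x • h x‖ = ‖h x‖ * |p x - q x| := fun x => by
    rw [← sub_smul, norm_smul, Real.norm_eq_abs, mul_comm]
  have hint : Integrable (fun x => ‖h x‖ * |p x - q x|) γ := by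
    simp_rw [← hdiff]
    exact (hhP.sub hhQ).norm
  set Δ := ∫ x, ‖h x‖ * |p x - q x| ∂γ with hΔ
  have hle : ‖∫ x, (p x • h x - q x • h x) ∂γ‖ ≤ Δ := by
    refine (norm_integral_le_integral_norm _).trans (le_of_eq ?_)
    simp_rw [hdiff, hΔ]
  have hΔ0 : 0 ≤ Δ := integral_nonneg fun x => by positivity
  have i1 : Integrable (fun x => q x - p x) γ := hq1.sub hp1
  have i2 : Integrable (fun x => p x • (Real.log (p x) - Real.log (q x)) + (q x - p x)) γ :=
    hlog.add i1
  have i3 : Integrable (fun x => p x • ‖h x‖ ^ 2 + q x • ‖h x‖ ^ 2) γ := hhP2.add hhQ2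
  -- The integral of q − p vanishes. The discriminant of this nonnegative quadratic then gives Δ² ≤
  -- 2VD.
  have key : ∀ t : ℝ, 0 ≤ (2 * V) * (t * t) + (-2 * Δ) * t + D := by
    intro t
    have h1 : ∫ x, 2 * t * (‖h x‖ * |p x - q x|) ∂γ ≤
        ∫ x, ((p x • (Real.log (p x) - Real.log (q x)) + (q x - p x)) +
          2 * t ^ 2 * (p x • ‖h x‖ ^ 2 + q x • ‖h x‖ ^ 2)) ∂γ := by
      refine integral_mono (hint.const_mul _)
        (i2.add (i3.const_mul _)) fun x => ?_
      refine (two_mul_mul_abs_sub_le (hp0 x) (hq0 x) ‖h x‖ t).trans (le_of_eq ?_)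
      simp only [smul_eq_mul]
      ring
    rw [integral_const_mul, integral_add i2 (i3.const_mul _),
      integral_add hlog i1, integral_const_mul, integral_add hhP2 hhQ2,
      integral_sub hq1 hp1, hpi, hqi, ← hV, ← hD, ← hΔ] at h1
    linarith
  have := discrim_le_zero key
  rw [discrim] at this
  calc _ ≤ Δ ^ 2 := by gcongr
    _ ≤ _ := by linarith

end Divergence


/-! ### Exponential moments and translates of the standard Gaussian. -/

section Translation

open scoped RealInnerProductSpace

variable {E : Type*} [NormedAddCommGroup E] [InnerProductSpace ℝ E] [FiniteDimensional ℝ E]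
  [MeasurableSpace E] [BorelSpace E]

/-- In orthonormal coordinates the integral factors into one-dimensional ones, each equal to
exp(z²/2) with z complex. The mixed form serves both the real exponential moments (t = 0) and the
characteristic functions of translated or tilted Gaussians. -/
theorem integral_cexp_inner_stdGaussian (a t : E) :
    ∫ x, Complex.exp (⟪x, a⟫ + ⟪x, t⟫ * Complex.I) ∂(stdGaussian E) =
      Complex.exp ((‖a‖ ^ 2 - ‖t‖ ^ 2) / 2 + ⟪a, t⟫ * Complex.I) := by
  rw [stdGaussian, integral_map (Measurable.aemeasurable (by fun_prop))
    (Measurable.aestronglyMeasurable (by fun_prop))]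
  set b := stdOrthonormalBasis ℝ E
  have h1 : ∀ x : Fin (Module.finrank ℝ E) → ℝ,
      Complex.exp (⟪∑ i, x i • b i, a⟫ + ⟪∑ i, x i • b i, t⟫ * Complex.I) =
        ∏ i, Complex.exp ((⟪b i, a⟫ + ⟪b i, t⟫ * Complex.I) * x i) := by
    intro x
    rw [← Complex.exp_sum, sum_inner, sum_inner]
    push_cast
    rw [Finset.sum_mul, ← Finset.sum_add_distrib]
    congr 1
    refine Finset.sum_congr rfl fun i _ => ?_
    rw [real_inner_smul_left, real_inner_smul_left]
    push_cast; ring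
  simp_rw [h1]
  rw [integral_fintype_prod_eq_prod
    (f := fun i (y : ℝ) => Complex.exp ((⟪b i, a⟫ + ⟪b i, t⟫ * Complex.I) * y))]
  have h2 : ∀ z : ℂ, ∫ y : ℝ, Complex.exp (z * y) ∂(gaussianReal 0 1) = Complex.exp (z ^ 2 / 2) := by
    intro z
    have := complexMGF_gaussianReal (X := id) (p := gaussianReal 0 1) Measure.map_id z
    simpa [complexMGF] using this
  simp_rw [h2]
  rw [← Complex.exp_sum]
  congr 1
  have e1 := b.sum_sq_inner_right a
  have e2 := b.sum_sq_inner_right t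
  have e3 := b.sum_inner_mul_inner a t
  have e1' : ∑ i, (⟪b i, a⟫ : ℂ) ^ 2 = (‖a‖ : ℂ) ^ 2 := by exact_mod_cast e1
  have e2' : ∑ i, (⟪b i, t⟫ : ℂ) ^ 2 = (‖t‖ : ℂ) ^ 2 := by exact_mod_cast e2
  have e3' : ∑ i, (⟪b i, a⟫ : ℂ) * ⟪b i, t⟫ = (⟪a, t⟫ : ℂ) := by
    simp_rw [real_inner_comm (b _) a] at *
    exact_mod_cast e3
  rw [← e1', ← e2', ← e3', ← Finset.sum_sub_distrib, Finset.sum_div, Finset.sum_mul,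
    ← Finset.sum_add_distrib]
  refine Finset.sum_congr rfl fun i _ => ?_
  linear_combination (⟪b i, t⟫ : ℂ) ^ 2 / 2 * Complex.I_sq

theorem integral_exp_inner_stdGaussian (a : E) :
    ∫ x, Real.exp ⟪x, a⟫ ∂(stdGaussian E) = Real.exp (‖a‖ ^ 2 / 2) := by
  have h := integral_cexp_inner_stdGaussian a 0
  simp only [inner_zero_right, Complex.ofReal_zero, zero_mul, add_zero, norm_zero, ne_eq,
    OfNat.ofNat_ne_zero, not_false_eq_true, zero_pow, sub_zero] at h
  have h2 : ((∫ x, Real.exp ⟪x, a⟫ ∂(stdGaussian E) : ℝ) : ℂ) = (Real.exp (‖a‖ ^ 2 / 2) : ℝ) := by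
    rw [← integral_complex_ofReal]
    push_cast
    exact h
  exact_mod_cast h2

theorem integrable_exp_inner_stdGaussian (a : E) :
    Integrable (fun x => Real.exp ⟪x, a⟫) (stdGaussian E) := by
  -- A non-integrable function has Bochner integral 0 by convention, so a nonzero value proves
  -- integrability.
  refine Integrable.of_integral_ne_zero ?_
  rw [integral_exp_inner_stdGaussian]
  exact (Real.exp_pos _).ne'

/-- The density of a translate of the standard Gaussian measure (Cameron-Martin formula). -/
theorem map_add_stdGaussian (a : E) :
    (stdGaussian E).map (fun x => a + x) =
      (stdGaussian E).withDensity
        fun x => ENNReal.ofReal (Real.exp (⟪x, a⟫ - ‖a‖ ^ 2 / 2)) := by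
  have hm : Measurable fun x : E => Real.exp (⟪x, a⟫ - ‖a‖ ^ 2 / 2) := by fun_prop
  have hfin : IsFiniteMeasure ((stdGaussian E).withDensity
      fun x => ENNReal.ofReal (Real.exp (⟪x, a⟫ - ‖a‖ ^ 2 / 2))) := by
    refine isFiniteMeasure_withDensity_ofReal ?_
    simp_rw [Real.exp_sub]
    exact ((integrable_exp_inner_stdGaussian a).div_const _).2
  have : IsProbabilityMeasure ((stdGaussian E).map (fun x => a + x)) :=
    Measure.isProbabilityMeasure_map (by fun_prop)
  refine Measure.ext_of_charFun (funext fun t => ?_)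
  rw [charFun_apply, charFun_apply, integral_withDensity_ofReal hm fun _ => Real.exp_pos _,
    integral_map (by fun_prop) (Measurable.aestronglyMeasurable (by fun_prop))]
  have h1 : ∀ x : E, Complex.exp (⟪a + x, t⟫ * Complex.I) =
      Complex.exp (⟪a, t⟫ * Complex.I) * Complex.exp (⟪x, (0 : E)⟫ + ⟪x, t⟫ * Complex.I) := by
    intro x
    rw [← Complex.exp_add, inner_add_left, inner_zero_right]
    push_cast
    congr 1; ring
  have h2 : ∀ x : E, Real.exp (⟪x, a⟫ - ‖a‖ ^ 2 / 2) • Complex.exp (⟪x, t⟫ * Complex.I) =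
      Complex.exp (-‖a‖ ^ 2 / 2) * Complex.exp (⟪x, a⟫ + ⟪x, t⟫ * Complex.I) := by
    intro x
    rw [Complex.real_smul, Complex.ofReal_exp, ← Complex.exp_add, ← Complex.exp_add]
    push_cast
    congr 1; ring
  simp_rw [h1, h2]
  rw [integral_const_mul, integral_const_mul, integral_cexp_inner_stdGaussian,
    integral_cexp_inner_stdGaussian, ← Complex.exp_add, ← Complex.exp_add]
  congr 1
  simp
  ring

theorem integrable_norm_pow_stdGaussian (n : ℕ) :
    Integrable (fun x : E => ‖x‖ ^ n) (stdGaussian E) :=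
  (IsGaussian.memLp_id (stdGaussian E) n (by simp)).integrable_norm_pow' 

theorem integrable_const_add_norm_pow_stdGaussian (K : ℝ) (n : ℕ) :
    Integrable (fun x : E => (K + ‖x‖) ^ n) (stdGaussian E) := by
  simp_rw [add_pow]
  exact integrable_finsetSum _ fun i _ =>
    ((integrable_norm_pow_stdGaussian _).const_mul _).mul_const _

end Translation


/-! ### The law of the observation: scaling, density and growth. -/

section SignalLaw

open scoped RealInnerProductSpace

variable {L : ℕ}

instance isProbabilityMeasure_restrict_Icc :
    IsProbabilityMeasure ((volume : Measure ℝ).restrict (Set.Icc 0 1)) :=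
  ⟨by simp⟩

theorem continuous_rot_add (σ : ℝ) (θ : EuclideanSpace ℝ (Fin L)) :
    Continuous fun p : ℝ × EuclideanSpace ℝ (Fin L) => rot p.1 θ + σ • p.2 :=
  ((continuous_rot θ).comp continuous_fst).add (continuous_snd.const_smul σ)

theorem signalLaw_eq_map (σ : ℝ) (θ : EuclideanSpace ℝ (Fin L)) :
    signalLaw σ θ = Measure.map (fun p : ℝ × EuclideanSpace ℝ (Fin L) => rot p.1 θ + σ • p.2)
      ((volume.restrict (Set.Icc (0 : ℝ) 1)).prod (stdGaussian (EuclideanSpace ℝ (Fin L)))) :=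
  rfl

instance isProbabilityMeasure_signalLaw (σ : ℝ) (θ : EuclideanSpace ℝ (Fin L)) :
    IsProbabilityMeasure (signalLaw σ θ) := by
  rw [signalLaw_eq_map]
  exact Measure.isProbabilityMeasure_map (continuous_rot_add σ θ).measurable.aemeasurable

theorem signalLaw_eq_map_smul (hL : Odd L) {σ : ℝ} (hσ : σ ≠ 0) (θ : EuclideanSpace ℝ (Fin L)) :
    signalLaw σ θ = (signalLaw 1 (σ⁻¹ • θ)).map (fun y => σ • y) := by
  rw [signalLaw_eq_map, signalLaw_eq_map,
    Measure.map_map (by fun_prop) (continuous_rot_add _ _).measurable]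
  congr 1
  funext p
  simp [rot, phaseShift_smul hL, smul_smul, hσ]

/-- The divergence at noise level `σ` is the divergence at noise level one of the rescaled
signals. -/
theorem divergence_eq_divergence_one (hL : Odd L) {σ : ℝ} (hσ : σ ≠ 0)
    (θ φ : EuclideanSpace ℝ (Fin L)) :
    divergence σ θ φ = divergence 1 (σ⁻¹ • θ) (σ⁻¹ • φ) := by
  have h1 : ∀ θ : EuclideanSpace ℝ (Fin L),
      signalLaw 1 (σ⁻¹ • θ) = (signalLaw σ θ).map (fun y => σ⁻¹ • y) := by
    intro θ
    rw [signalLaw_eq_map_smul hL hσ, Measure.map_map (by fun_prop) (by fun_prop)]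
    simp [Function.comp_def, smul_smul, hσ]
  unfold divergence
  congr 1
  -- Scaling is invertible, so data processing applies in both directions.
  refine le_antisymm ?_ ?_
  · rw [signalLaw_eq_map_smul hL hσ, signalLaw_eq_map_smul hL hσ]
    exact InformationTheory.klDiv_map_le _ _ (measurable_const_smul _)
  · rw [h1, h1]
    exact InformationTheory.klDiv_map_le _ _ (measurable_const_smul _)

/-- The density of the law at noise level one with respect to the standard Gaussian measure. -/
def density (θ y : EuclideanSpace ℝ (Fin L)) : ℝ :=
  ∫ s in Set.Icc (0 : ℝ) 1, Real.exp (⟪y, rot s θ⟫ - ‖θ‖ ^ 2 / 2)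

theorem continuous_density_integrand (θ : EuclideanSpace ℝ (Fin L)) :
    Continuous fun p : EuclideanSpace ℝ (Fin L) × ℝ =>
      Real.exp (⟪p.1, rot p.2 θ⟫ - ‖θ‖ ^ 2 / 2) :=
  Real.continuous_exp.comp
    ((continuous_fst.inner ((continuous_rot θ).comp continuous_snd)).sub continuous_const)

theorem integrableOn_density_integrand (θ y : EuclideanSpace ℝ (Fin L)) :
    IntegrableOn (fun s : ℝ => Real.exp (⟪y, rot s θ⟫ - ‖θ‖ ^ 2 / 2)) (Set.Icc 0 1) :=
  ((continuous_density_integrand θ).comp (Continuous.prodMk_right y)).continuousOn.integrableOn_Icc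

theorem measurable_density (θ : EuclideanSpace ℝ (Fin L)) : Measurable (density θ) :=
  ((continuous_density_integrand θ).stronglyMeasurable.integral_prod_right).measurable

/-- For a fixed shift the law is a translated Gaussian, with density given by `map_add_stdGaussian`;
Tonelli averages it over the shift. Shifts preserve the norm, so the normalising term does not
depend on s. -/
theorem signalLaw_one_eq_withDensity (hL : Odd L) (θ : EuclideanSpace ℝ (Fin L)) :
    signalLaw 1 θ =
      (stdGaussian (EuclideanSpace ℝ (Fin L))).withDensity
        fun y => ENNReal.ofReal (density θ y) := by
  ext A hA
  have hm := (continuous_rot_add 1 θ).measurable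
  rw [signalLaw_eq_map, Measure.map_apply hm hA, Measure.prod_apply (hm hA), withDensity_apply _ hA]
  have h1 : ∀ s : ℝ, stdGaussian (EuclideanSpace ℝ (Fin L))
      (Prod.mk s ⁻¹' ((fun p : ℝ × EuclideanSpace ℝ (Fin L) => rot p.1 θ + (1 : ℝ) • p.2) ⁻¹' A)) =
      ∫⁻ y in A, ENNReal.ofReal (Real.exp (⟪y, rot s θ⟫ - ‖θ‖ ^ 2 / 2))
        ∂(stdGaussian (EuclideanSpace ℝ (Fin L))) := by
    intro s
    rw [← withDensity_apply _ hA]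
    conv_rhs => rw [← norm_rot hL s θ]
    rw [← map_add_stdGaussian, Measure.map_apply (by fun_prop) hA]
    simp [Set.preimage]
  simp_rw [h1]
  rw [lintegral_lintegral_swap]
  · refine lintegral_congr fun y => ?_
    rw [density, ofReal_integral_eq_lintegral_ofReal (integrableOn_density_integrand θ y)
      (.of_forall fun s => (Real.exp_pos _).le)]
  · exact ((continuous_density_integrand θ).comp continuous_swap).measurable.ennreal_ofReal.aemeasurable

/-- Cauchy–Schwarz under the integral. With `density_le_exp` it makes the log-density grow at most
linearly in ‖y‖, which yields integrability and the bound for large φ. -/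
theorem exp_le_density (hL : Odd L) (θ y : EuclideanSpace ℝ (Fin L)) :
    Real.exp (-(‖y‖ * ‖θ‖) - ‖θ‖ ^ 2 / 2) ≤ density θ y := by
  have h1 : ∫ s in Set.Icc (0 : ℝ) 1, Real.exp (-(‖y‖ * ‖θ‖) - ‖θ‖ ^ 2 / 2) ≤ density θ y := by
    refine integral_mono (integrable_const _) (integrableOn_density_integrand θ y) fun s => ?_
    have := (abs_le.1 (abs_real_inner_le_norm y (rot s θ))).1
    rw [norm_rot hL] at this
    exact Real.exp_le_exp.2 (by linarith)
  simpa using h1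

theorem density_le_exp (hL : Odd L) (θ y : EuclideanSpace ℝ (Fin L)) :
    density θ y ≤ Real.exp (‖y‖ * ‖θ‖ - ‖θ‖ ^ 2 / 2) := by
  have h1 : density θ y ≤ ∫ s in Set.Icc (0 : ℝ) 1, Real.exp (‖y‖ * ‖θ‖ - ‖θ‖ ^ 2 / 2) := by
    refine integral_mono (integrableOn_density_integrand θ y) (integrable_const _) fun s => ?_
    have := (abs_le.1 (abs_real_inner_le_norm y (rot s θ))).2
    rw [norm_rot hL] at this
    exact Real.exp_le_exp.2 (by linarith)
  simpa using h1

theorem density_pos (hL : Odd L) (θ y : EuclideanSpace ℝ (Fin L)) : 0 < density θ y :=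
  (Real.exp_pos _).trans_le (exp_le_density hL θ y)

theorem le_log_density (hL : Odd L) (θ y : EuclideanSpace ℝ (Fin L)) :
    -(‖y‖ * ‖θ‖) - ‖θ‖ ^ 2 / 2 ≤ Real.log (density θ y) :=
  (Real.le_log_iff_exp_le (density_pos hL θ y)).2 (exp_le_density hL θ y)

theorem log_density_le (hL : Odd L) (θ y : EuclideanSpace ℝ (Fin L)) :
    Real.log (density θ y) ≤ ‖y‖ * ‖θ‖ - ‖θ‖ ^ 2 / 2 :=
  (Real.log_le_iff_le_exp (density_pos hL θ y)).2 (density_le_exp hL θ y)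

theorem integrable_norm_pow_signalLaw (hL : Odd L) (θ : EuclideanSpace ℝ (Fin L)) (n : ℕ) :
    Integrable (fun y => ‖y‖ ^ n) (signalLaw 1 θ) := by
  have hc := continuous_rot_add 1 θ
  rw [signalLaw_eq_map, integrable_map_measure (by fun_prop) hc.measurable.aemeasurable]
  refine Integrable.mono' ((integrable_const_add_norm_pow_stdGaussian
    (E := EuclideanSpace ℝ (Fin L)) ‖θ‖ n).comp_snd _)
    ((hc.norm.pow n).aestronglyMeasurable) (.of_forall fun p => ?_)
  simp only [Function.comp, norm_pow, norm_norm, one_smul]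
  gcongr
  exact (norm_add_le _ _).trans (by rw [norm_rot hL])

theorem integral_norm_pow_signalLaw_le (hL : Odd L) {θ : EuclideanSpace ℝ (Fin L)} {K : ℝ}
    (hθ : ‖θ‖ ≤ K) (n : ℕ) :
    ∫ y, ‖y‖ ^ n ∂(signalLaw 1 θ) ≤
      ∫ x, (K + ‖x‖) ^ n ∂(stdGaussian (EuclideanSpace ℝ (Fin L))) := by
  have hc := continuous_rot_add 1 θ
  have h1 := integrable_norm_pow_signalLaw hL θ n
  rw [signalLaw_eq_map, integrable_map_measure (by fun_prop) hc.measurable.aemeasurable] at h1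
  have h2 := (integrable_const_add_norm_pow_stdGaussian
    (E := EuclideanSpace ℝ (Fin L)) K n).comp_snd (volume.restrict (Set.Icc (0 : ℝ) 1))
  have h3 : ∫ p, (K + ‖p.2‖) ^ n ∂((volume.restrict (Set.Icc (0 : ℝ) 1)).prod
      (stdGaussian (EuclideanSpace ℝ (Fin L)))) =
      ∫ x, (K + ‖x‖) ^ n ∂(stdGaussian (EuclideanSpace ℝ (Fin L))) := by
    rw [integral_fun_snd (fun x : EuclideanSpace ℝ (Fin L) => (K + ‖x‖) ^ n)]
    simp
  rw [signalLaw_eq_map, integral_map hc.measurable.aemeasurable (by fun_prop), ← h3]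
  refine integral_mono h1 h2 fun p => ?_
  simp only [one_smul]
  gcongr
  exact (norm_add_le _ _).trans (by rw [norm_rot hL]; gcongr)

theorem integrable_log_density_sub (hL : Odd L) (θ φ : EuclideanSpace ℝ (Fin L)) :
    Integrable (fun y => Real.log (density θ y) - Real.log (density φ y)) (signalLaw 1 θ) := by
  have h1 : Integrable (fun y => ‖y‖ * (‖θ‖ + ‖φ‖) + (‖θ‖ ^ 2 / 2 + ‖φ‖ ^ 2 / 2))
      (signalLaw 1 θ) := by
    have := integrable_norm_pow_signalLaw hL θ 1
    simp_rw [pow_one] at this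
    exact (this.mul_const _).add (integrable_const _)
  refine h1.mono' ((measurable_density θ).log.sub (measurable_density φ).log).aestronglyMeasurable
    (.of_forall fun y => ?_)
  have a1 := le_log_density hL θ y
  have a2 := log_density_le hL θ y
  have a3 := le_log_density hL φ y
  have a4 := log_density_le hL φ y
  have b1 := sq_nonneg ‖θ‖
  have b2 := sq_nonneg ‖φ‖
  rw [Real.norm_eq_abs, abs_le]
  constructor <;> linarith

theorem divergence_one_eq (hL : Odd L) (θ φ : EuclideanSpace ℝ (Fin L)) :
    divergence 1 θ φ =
      ∫ y, (Real.log (density θ y) - Real.log (density φ y)) ∂(signalLaw 1 θ) :=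
  toReal_klDiv_withDensity (measurable_density θ) (measurable_density φ) (density_pos hL θ)
    (density_pos hL φ) (signalLaw_one_eq_withDensity hL θ) (signalLaw_one_eq_withDensity hL φ)

/-- The divergence grows quadratically in the norm of the second signal. -/
theorem exists_forall_sq_norm_le_divergence (hL : Odd L) :
    ∃ K : ℝ, 0 < K ∧ ∀ θ φ : EuclideanSpace ℝ (Fin L), ‖θ‖ ≤ 1 → K ≤ ‖φ‖ →
      ‖φ‖ ^ 2 ≤ 4 * divergence 1 θ φ := by
  set B := ∫ x, (1 + ‖x‖) ^ 1 ∂(stdGaussian (EuclideanSpace ℝ (Fin L))) with hB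
  have hB0 : 0 ≤ B := integral_nonneg fun x => by positivity
  -- Below, D ≥ ‖φ‖²/2 − 1/2 − B(1 + ‖φ‖); this threshold lets ‖φ‖²/4 absorb the negative terms.
  refine ⟨4 * (B + 1), by positivity, fun θ φ hθ hφ => ?_⟩
  have hi := integrable_norm_pow_signalLaw hL θ 1
  simp_rw [pow_one] at hi
  have hBy : ∫ y, ‖y‖ ∂(signalLaw 1 θ) ≤ B := by
    simpa only [pow_one, hB] using integral_norm_pow_signalLaw_le hL hθ 1
  have h1 : ∫ y, ((‖φ‖ ^ 2 / 2 - 1 / 2) - ‖y‖ * (1 + ‖φ‖)) ∂(signalLaw 1 θ) ≤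
      divergence 1 θ φ := by
    rw [divergence_one_eq hL]
    refine integral_mono ((integrable_const _).sub (hi.mul_const _))
      (integrable_log_density_sub hL θ φ) fun y => ?_
    have a1 := le_log_density hL θ y
    have a2 := log_density_le hL φ y
    have a3 : ‖y‖ * ‖θ‖ ≤ ‖y‖ * 1 := by gcongr
    have a4 : ‖θ‖ ^ 2 ≤ 1 := pow_le_one₀ (norm_nonneg _) hθ
    simp only
    linarith
  rw [integral_sub (integrable_const _) (hi.mul_const _), integral_mul_const] at h1
  simp only [integral_const, probReal_univ, smul_eq_mul, one_mul] at h1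
  have h2 : (∫ y, ‖y‖ ∂(signalLaw 1 θ)) * (1 + ‖φ‖) ≤ B * (1 + ‖φ‖) := by gcongr
  nlinarith

end SignalLaw


/-! ### Moments of the shifted signal and shift invariants. -/

section Moments

variable {L : ℕ} {ι : Type*}

/-- The mixed moment of the Fourier coefficients of the randomly shifted signal. -/
def moment (j : ι → ℤ) (A : Finset ι) (θ : EuclideanSpace ℝ (Fin L)) : ℂ :=
  ∫ s in Set.Icc (0 : ℝ) 1, ∏ i ∈ A, dft (rot s θ) (j i)

/-- The mixed moment of the Fourier coefficients of the noise. -/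
def noiseMoment (L : ℕ) (j : ι → ℤ) (A : Finset ι) : ℂ :=
  ∫ x, ∏ i ∈ A, dft x (j i) ∂(stdGaussian (EuclideanSpace ℝ (Fin L)))

theorem continuous_prod_dft (j : ι → ℤ) (A : Finset ι) :
    Continuous fun y : EuclideanSpace ℝ (Fin L) => ∏ i ∈ A, dft y (j i) :=
  continuous_finsetProd _ fun i _ => continuous_dft (j i)

theorem norm_prod_dft_le (hL : Odd L) {j : ι → ℤ} (hj : ∀ i, |j i| ≤ ((L / 2 : ℕ) : ℤ))
    (A : Finset ι) (y : EuclideanSpace ℝ (Fin L)) :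
    ‖∏ i ∈ A, dft y (j i)‖ ≤ ‖y‖ ^ A.card := by
  rw [norm_prod]
  exact (Finset.prod_le_prod (fun _ _ => norm_nonneg _) fun i _ => norm_dft_le hL y (hj i)).trans
    (by simp)

theorem integrable_prod_dft_stdGaussian (hL : Odd L) {j : ι → ℤ}
    (hj : ∀ i, |j i| ≤ ((L / 2 : ℕ) : ℤ)) (A : Finset ι) :
    Integrable (fun y : EuclideanSpace ℝ (Fin L) => ∏ i ∈ A, dft y (j i))
      (stdGaussian (EuclideanSpace ℝ (Fin L))) :=
  (integrable_norm_pow_stdGaussian A.card).mono' (continuous_prod_dft j A).aestronglyMeasurable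
    (.of_forall fun y => norm_prod_dft_le hL hj A y)

theorem integrable_prod_dft_signalLaw (hL : Odd L) {j : ι → ℤ}
    (hj : ∀ i, |j i| ≤ ((L / 2 : ℕ) : ℤ)) (A : Finset ι) (θ : EuclideanSpace ℝ (Fin L)) :
    Integrable (fun y => ∏ i ∈ A, dft y (j i)) (signalLaw 1 θ) :=
  (integrable_norm_pow_signalLaw hL θ A.card).mono' (continuous_prod_dft j A).aestronglyMeasurable
    (.of_forall fun y => norm_prod_dft_le hL hj A y)

theorem norm_prod_dft_sq_le (hL : Odd L) {j : ι → ℤ} (hj : ∀ i, |j i| ≤ ((L / 2 : ℕ) : ℤ))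
    (A : Finset ι) (y : EuclideanSpace ℝ (Fin L)) :
    ‖∏ i ∈ A, dft y (j i)‖ ^ 2 ≤ ‖y‖ ^ (A.card * 2) := by
  rw [pow_mul]
  gcongr
  exact norm_prod_dft_le hL hj A y

theorem integrable_norm_prod_dft_sq_signalLaw (hL : Odd L) {j : ι → ℤ}
    (hj : ∀ i, |j i| ≤ ((L / 2 : ℕ) : ℤ)) (A : Finset ι) (θ : EuclideanSpace ℝ (Fin L)) :
    Integrable (fun y => ‖∏ i ∈ A, dft y (j i)‖ ^ 2) (signalLaw 1 θ) :=
  (integrable_norm_pow_signalLaw hL θ (A.card * 2)).mono'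
    ((continuous_prod_dft j A).norm.pow 2).aestronglyMeasurable
    (.of_forall fun y => by
      rw [Real.norm_of_nonneg (by positivity)]
      exact norm_prod_dft_sq_le hL hj A y)

/-- Expand each factor as signal plus noise; independence splits every term of the expansion. -/
theorem integral_prod_dft_signalLaw [DecidableEq ι] (hL : Odd L) {j : ι → ℤ}
    (hj : ∀ i, |j i| ≤ ((L / 2 : ℕ) : ℤ)) (A : Finset ι) (θ : EuclideanSpace ℝ (Fin L)) :
    ∫ y, ∏ i ∈ A, dft y (j i) ∂(signalLaw 1 θ) =
      ∑ B ∈ A.powerset, moment j B θ * noiseMoment L j (A \ B) := by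
  have hc := continuous_rot_add 1 θ
  rw [signalLaw_eq_map, integral_map hc.measurable.aemeasurable
    (continuous_prod_dft j A).aestronglyMeasurable]
  simp_rw [one_smul, dft_add, Finset.prod_add]
  rw [integral_finsetSum]
  · refine Finset.sum_congr rfl fun B _ => ?_
    exact integral_prod_mul (fun s : ℝ => ∏ i ∈ B, dft (rot s θ) (j i))
      (fun x : EuclideanSpace ℝ (Fin L) => ∏ i ∈ A \ B, dft x (j i))
  · intro B _
    refine Integrable.mul_prod (f := fun s : ℝ => ∏ i ∈ B, dft (rot s θ) (j i))
      (g := fun x : EuclideanSpace ℝ (Fin L) => ∏ i ∈ A \ B, dft x (j i)) ?_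
      (integrable_prod_dft_stdGaussian hL hj _)
    exact ((continuous_prod_dft j B).comp (continuous_rot θ)).continuousOn.integrableOn_Icc

theorem noiseMoment_empty (j : ι → ℤ) : noiseMoment L j ∅ = 1 := by
  simp [noiseMoment]

/-- Every mixed moment of the signal is controlled by the divergence. -/
theorem exists_norm_moment_sub_le (hL : Odd L) {j : ι → ℤ}
    (hj : ∀ i, |j i| ≤ ((L / 2 : ℕ) : ℤ)) (K : ℝ) (A : Finset ι) :
    ∃ C : ℝ, 0 ≤ C ∧ ∀ θ φ : EuclideanSpace ℝ (Fin L), ‖θ‖ ≤ K → ‖φ‖ ≤ K →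
      ‖moment j A θ - moment j A φ‖ ≤ C * √(divergence 1 θ φ) := by
  classical
  induction A using Finset.strongInduction with
  | H A ih =>
  choose! C hC0 hC using ih
  set V := ∫ x, (K + ‖x‖) ^ (A.card * 2) ∂(stdGaussian (EuclideanSpace ℝ (Fin L))) with hV
  -- The term B = A of the expansion carries noise moment 1, so it can be isolated. The first
  -- summand comes from the test-function inequality, the others from the induction hypothesis on
  -- proper subsets.
  refine ⟨√(4 * V) + ∑ B ∈ A.ssubsets, C B * ‖noiseMoment L j (A \ B)‖,
    add_nonneg (Real.sqrt_nonneg _) (Finset.sum_nonneg fun B hB =>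
      mul_nonneg (hC0 B (Finset.mem_ssubsets.1 hB)) (norm_nonneg _)), fun θ φ hθ hφ => ?_⟩
  have hD : 0 ≤ divergence 1 θ φ := ENNReal.toReal_nonneg
  have h1 := norm_integral_sub_integral_sq_le (measurable_density θ) (measurable_density φ)
    (density_pos hL θ) (density_pos hL φ) (signalLaw_one_eq_withDensity hL θ)
    (signalLaw_one_eq_withDensity hL φ) (integrable_log_density_sub hL θ φ)
    (integrable_prod_dft_signalLaw hL hj A θ) (integrable_prod_dft_signalLaw hL hj A φ)
    (integrable_norm_prod_dft_sq_signalLaw hL hj A θ)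
    (integrable_norm_prod_dft_sq_signalLaw hL hj A φ)
  have hVle : ∀ θ : EuclideanSpace ℝ (Fin L), ‖θ‖ ≤ K →
      ∫ y, ‖∏ i ∈ A, dft y (j i)‖ ^ 2 ∂(signalLaw 1 θ) ≤ V := fun θ hθ =>
    (integral_mono (integrable_norm_prod_dft_sq_signalLaw hL hj A θ)
      (integrable_norm_pow_signalLaw hL θ _) fun y => norm_prod_dft_sq_le hL hj A y).trans
      (integral_norm_pow_signalLaw_le hL hθ _)
  have h2 : ‖∫ y, ∏ i ∈ A, dft y (j i) ∂(signalLaw 1 θ) -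
      ∫ y, ∏ i ∈ A, dft y (j i) ∂(signalLaw 1 φ)‖ ≤ √(4 * V) * √(divergence 1 θ φ) := by
    rw [← Real.sqrt_mul' _ hD]
    refine Real.le_sqrt_of_sq_le (h1.trans ?_)
    refine mul_le_mul_of_nonneg_right ?_ hD
    linarith [hVle θ hθ, hVle φ hφ]
  have hsplit : ∀ f : Finset ι → ℂ, ∑ B ∈ A.powerset, f B = f A + ∑ B ∈ A.ssubsets, f B := by
    intro f
    rw [Finset.ssubsets, Finset.add_sum_erase _ _ (Finset.mem_powerset_self A)]
  have h3 : moment j A θ - moment j A φ =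
      (∫ y, ∏ i ∈ A, dft y (j i) ∂(signalLaw 1 θ) - ∫ y, ∏ i ∈ A, dft y (j i) ∂(signalLaw 1 φ)) -
      ∑ B ∈ A.ssubsets, (moment j B θ - moment j B φ) * noiseMoment L j (A \ B) := by
    rw [integral_prod_dft_signalLaw hL hj, integral_prod_dft_signalLaw hL hj, hsplit, hsplit,
      Finset.sdiff_self, noiseMoment_empty]
    simp_rw [sub_mul]
    rw [Finset.sum_sub_distrib]
    ring
  rw [h3, add_mul, Finset.sum_mul]
  refine (norm_sub_le _ _).trans (add_le_add h2 ((norm_sum_le _ _).trans ?_))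
  refine Finset.sum_le_sum fun B hB => ?_
  rw [norm_mul, mul_right_comm]
  exact mul_le_mul_of_nonneg_right (hC B (Finset.mem_ssubsets.1 hB) θ φ hθ hφ) (norm_nonneg _)

/-- The moments whose frequencies sum to zero are invariant under shifts. -/
theorem moment_eq_prod_dft (hL : Odd L) {j : ι → ℤ} (hj : ∀ i, |j i| ≤ ((L / 2 : ℕ) : ℤ))
    {A : Finset ι} (hA : ∑ i ∈ A, j i = 0) (θ : EuclideanSpace ℝ (Fin L)) :
    moment j A θ = ∏ i ∈ A, dft θ (j i) := by
  have hz : ∀ (z : Circle) (B : Finset ι), ∏ i ∈ B, (z : ℂ) ^ j i = (z : ℂ) ^ ∑ i ∈ B, j i := by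
    intro z B
    classical
    induction B using Finset.induction_on with
    | empty => simp
    | insert a B ha ih => rw [Finset.prod_insert ha, Finset.sum_insert ha, ih,
        zpow_add₀ (Circle.coe_ne_zero z)]
  have h1 : ∀ s : ℝ, ∏ i ∈ A, dft (rot s θ) (j i) = ∏ i ∈ A, dft θ (j i) := by
    intro s
    simp_rw [rot, dft_phaseShift hL _ _ _ (hj _)]
    rw [Finset.prod_mul_distrib, hz, hA, zpow_zero, one_mul]
  simp [moment, h1]

/-- The invariant `θ̂_j^p · conj(θ̂_k)^q`. -/
def invariant (p q j k : ℕ) (θ : EuclideanSpace ℝ (Fin L)) : ℂ :=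
  dft θ j ^ p * (starRingEnd ℂ (dft θ k)) ^ q

theorem invariant_smul (p q j k : ℕ) (a : ℝ) (θ : EuclideanSpace ℝ (Fin L)) :
    invariant p q j k (a • θ) = a ^ (p + q) * invariant p q j k θ := by
  simp only [invariant, dft_smul, map_mul, Complex.conj_ofReal]
  ring

theorem exists_norm_invariant_sub_le (hL : Odd L) (K : ℝ) {p q j k : ℕ} (hj : j ≤ L / 2)
    (hk : k ≤ L / 2) (hpq : p * j = q * k) :
    ∃ C : ℝ, 0 ≤ C ∧ ∀ θ φ : EuclideanSpace ℝ (Fin L), ‖θ‖ ≤ K → ‖φ‖ ≤ K →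
      ‖invariant p q j k θ - invariant p q j k φ‖ ≤ C * √(divergence 1 θ φ) := by
  -- The frequency j taken p times and −k taken q times sum to zero by `hpq`; the negative sign
  -- produces the conjugates.
  set J : Fin p ⊕ Fin q → ℤ := Sum.elim (fun _ => (j : ℤ)) (fun _ => -(k : ℤ)) with hJ
  have hJ' : ∀ i, |J i| ≤ ((L / 2 : ℕ) : ℤ) := by
    rintro (i | i) <;> simp only [hJ, Sum.elim_inl, Sum.elim_inr, abs_neg, Nat.abs_cast] <;> omega
  have hsum : ∑ i, J i = 0 := by
    rw [Fintype.sum_sum_type]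
    simp only [hJ, Sum.elim_inl, Sum.elim_inr, Finset.sum_const, Finset.card_univ,
      Fintype.card_fin, nsmul_eq_mul]
    have : (p : ℤ) * j = q * k := by exact_mod_cast hpq
    linarith
  have h1 : ∀ θ : EuclideanSpace ℝ (Fin L), invariant p q j k θ = moment J Finset.univ θ := by
    intro θ
    rw [moment_eq_prod_dft hL hJ' hsum, Fintype.prod_sum_type]
    simp [hJ, invariant, dft_neg]
  simp_rw [h1]
  exact exists_norm_moment_sub_le hL hJ' K Finset.univ

end Moments


/-! ### Recovering a common shift from approximate phase relations. -/

section CircleRelations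

theorem norm_circle_mul_sub_one_le (x y : Circle) :
    ‖((x * y : Circle) : ℂ) - 1‖ ≤ ‖(x : ℂ) - 1‖ + ‖(y : ℂ) - 1‖ := by
  rw [show ((x * y : Circle) : ℂ) - 1 = x * ((y : ℂ) - 1) + ((x : ℂ) - 1) by
    rw [Circle.coe_mul]; ring]
  refine (norm_add_le _ _).trans ?_
  rw [norm_mul, Circle.norm_coe, one_mul, add_comm]

theorem norm_circle_inv_sub_one (x : Circle) : ‖((x⁻¹ : Circle) : ℂ) - 1‖ = ‖(x : ℂ) - 1‖ := by
  have h : (x : ℂ) * (((x⁻¹ : Circle) : ℂ) - 1) = -((x : ℂ) - 1) := by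
    rw [mul_sub, ← Circle.coe_mul, mul_inv_cancel, Circle.coe_one]; ring
  rw [← norm_neg ((x : ℂ) - 1), ← h, norm_mul, Circle.norm_coe, one_mul]

theorem norm_circle_pow_sub_one_le (x : Circle) (n : ℕ) :
    ‖((x ^ n : Circle) : ℂ) - 1‖ ≤ n * ‖(x : ℂ) - 1‖ := by
  induction n with
  | zero => simp
  | succ n ih =>
    rw [pow_succ]
    refine (norm_circle_mul_sub_one_le _ _).trans ?_
    rw [Nat.cast_succ]
    linarith

theorem norm_circle_zpow_sub_one_le (x : Circle) (n : ℤ) :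
    ‖((x ^ n : Circle) : ℂ) - 1‖ ≤ n.natAbs * ‖(x : ℂ) - 1‖ := by
  obtain h | h := Int.natAbs_eq n
  · rw [h, zpow_natCast]
    simpa using norm_circle_pow_sub_one_le x n.natAbs
  · rw [h, zpow_neg, zpow_natCast, norm_circle_inv_sub_one]
    simpa using norm_circle_pow_sub_one_le x n.natAbs

theorem norm_circle_prod_sub_one_le {ι : Type*} (S : Finset ι) (x : ι → Circle) :
    ‖((∏ i ∈ S, x i : Circle) : ℂ) - 1‖ ≤ ∑ i ∈ S, ‖(x i : ℂ) - 1‖ := by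
  classical
  induction S using Finset.induction_on with
  | empty => simp
  | insert a S ha ih =>
    rw [Finset.prod_insert ha, Finset.sum_insert ha]
    exact (norm_circle_mul_sub_one_le _ _).trans (by gcongr)

theorem exists_circle_pow_eq (w : Circle) {d : ℕ} (hd : d ≠ 0) : ∃ z : Circle, z ^ d = w := by
  refine ⟨Circle.exp (Complex.arg w / d), ?_⟩
  rw [← Circle.exp_nsmul, nsmul_eq_mul, mul_div_cancel₀ _ (by exact_mod_cast hd), Circle.exp_arg]

/-- Points on the circle that almost satisfy the relations `w_j ^ (k / d) = w_k ^ (j / d)`,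
where `d` is the greatest common divisor of the indices, are almost of the form `z ^ j`. -/
theorem exists_forall_norm_sub_pow_le (S : Finset ℕ) (hS : ∀ j ∈ S, 0 < j) :
    ∃ N : ℝ, 0 ≤ N ∧ ∀ (w : ℕ → Circle) (δ : ℝ),
      (∀ j ∈ S, ∀ k ∈ S, ‖((w j ^ (k / S.gcd id) * (w k ^ (j / S.gcd id))⁻¹ : Circle) : ℂ) - 1‖
        ≤ δ) →
      ∃ z : Circle, ∀ k ∈ S, ‖(w k : ℂ) - (z : ℂ) ^ k‖ ≤ N * δ := by
  obtain rfl | ⟨j₀, hj₀⟩ := S.eq_empty_or_nonempty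
  · exact ⟨0, le_rfl, fun w δ _ => ⟨1, by simp⟩⟩
  set d := S.gcd id with hd
  have hd0 : d ≠ 0 := by
    intro h
    exact (hS j₀ hj₀).ne' (Finset.gcd_eq_zero_iff.1 h j₀ hj₀)
  have hdvd : ∀ j ∈ S, d ∣ j := fun j hj => Finset.gcd_dvd (f := id) hj
  -- Bézout coefficients for the integers j / d, whose greatest common divisor is 1.
  obtain ⟨n, hn⟩ : ∃ n : ℕ → ℤ, ∑ j ∈ S, n j * ((j / d : ℕ) : ℤ) = 1 := by
    obtain ⟨n, hn⟩ := Finset.gcd_eq_sum_mul S (fun j : ℕ => (j : ℤ))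
    have h1 : S.gcd (fun j : ℕ => (j : ℤ)) ∣ (d : ℤ) := by
      rw [← Int.natAbs_dvd_natAbs, Int.natAbs_natCast]
      refine Finset.dvd_gcd fun j hj => ?_
      simpa using Int.natAbs_dvd_natAbs.2 (Finset.gcd_dvd (f := fun j : ℕ => (j : ℤ)) hj)
    obtain ⟨e, he⟩ := h1
    refine ⟨fun j => e * n j, ?_⟩
    have hdz : (d : ℤ) ≠ 0 := by exact_mod_cast hd0
    refine mul_left_cancel₀ hdz ?_
    rw [mul_one, Finset.mul_sum]
    conv_rhs => rw [he, hn, mul_comm, Finset.mul_sum]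
    refine Finset.sum_congr rfl fun j hj => ?_
    have : (d : ℤ) * ((j / d : ℕ) : ℤ) = j := by exact_mod_cast Nat.mul_div_cancel' (hdvd j hj)
    rw [mul_left_comm, this, mul_assoc]
    ring
  refine ⟨∑ j ∈ S, ((n j).natAbs : ℝ), by positivity, fun w δ h => ?_⟩
  -- Then z^k is the product of (w_j^(k/d))^(n_j), while w_k is the product of (w_k^(j/d))^(n_j) by
  -- Bézout. Their quotient is a product of powers of the given relations.
  obtain ⟨z, hz⟩ := exists_circle_pow_eq (∏ j ∈ S, w j ^ n j) hd0
  refine ⟨z, fun k hk => ?_⟩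
  have h1 : (w k)⁻¹ * z ^ k =
      ∏ j ∈ S, (w j ^ (k / d) * (w k ^ (j / d))⁻¹) ^ n j := by
    obtain ⟨k', hk'⟩ := hdvd k hk
    have hkd : k / d = k' := by rw [hk']; exact Nat.mul_div_cancel_left _ (Nat.pos_of_ne_zero hd0)
    have h2 : (w k)⁻¹ = ∏ j ∈ S, ((w k ^ (j / d))⁻¹) ^ n j := by
      have h3 : ∀ (x : Circle) (T : Finset ℕ) (f : ℕ → ℤ), ∏ j ∈ T, x ^ f j = x ^ ∑ j ∈ T, f j := by
        intro x T f
        induction T using Finset.induction_on with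
        | empty => simp
        | insert a T ha ih => rw [Finset.prod_insert ha, Finset.sum_insert ha, ih, zpow_add]
      rw [← zpow_one (w k)⁻¹, ← hn, ← h3]
      refine Finset.prod_congr rfl fun j _ => ?_
      rw [← inv_pow, ← zpow_natCast, ← zpow_mul, mul_comm]
    have h4 : z ^ k = ∏ j ∈ S, (w j ^ (k / d)) ^ n j := by
      rw [hkd, hk', pow_mul, hz, ← Finset.prod_pow]
      refine Finset.prod_congr rfl fun j _ => ?_
      rw [← zpow_natCast, ← zpow_natCast, ← zpow_mul, ← zpow_mul, mul_comm]
    rw [h2, h4, ← Finset.prod_mul_distrib]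
    refine Finset.prod_congr rfl fun j _ => ?_
    rw [mul_zpow, mul_comm]
  have h5 : ‖(w k : ℂ) - (z : ℂ) ^ k‖ = ‖(((w k)⁻¹ * z ^ k : Circle) : ℂ) - 1‖ := by
    have h6 : (w k : ℂ) * ((((w k)⁻¹ * z ^ k : Circle) : ℂ) - 1) = -((w k : ℂ) - (z : ℂ) ^ k) := by
      rw [mul_sub, ← Circle.coe_mul, mul_inv_cancel_left, Circle.coe_pow]; ring
    rw [← norm_neg ((w k : ℂ) - (z : ℂ) ^ k), ← h6, norm_mul, Circle.norm_coe, one_mul]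
  rw [h5, h1, Finset.sum_mul]
  refine (norm_circle_prod_sub_one_le _ _).trans (Finset.sum_le_sum fun j hj => ?_)
  refine (norm_circle_zpow_sub_one_le _ _).trans ?_
  exact mul_le_mul_of_nonneg_left (h j hj k hk) (by positivity)

/-- A phase is available even at 0, so the coefficients of φ need no lower bound. -/
theorem exists_eq_norm_mul_circle (x : ℂ) : ∃ u : Circle, x = ‖x‖ * (u : ℂ) :=
  ⟨Circle.exp (Complex.arg x), by rw [Circle.coe_exp, Complex.norm_mul_exp_arg_mul_I]⟩

/-- Replacing r' by r costs |r − r'|, which is itself at most the distance of the two points. Only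
the first modulus weights the phase difference. -/
theorem mul_norm_circle_sub_le {r r' : ℝ} (hr : 0 ≤ r) (hr' : 0 ≤ r') (u v : Circle) :
    r * ‖(u : ℂ) - v‖ ≤ 2 * ‖r * (u : ℂ) - r' * (v : ℂ)‖ := by
  have h1 : r * ‖(u : ℂ) - v‖ = ‖r * (u : ℂ) - r * (v : ℂ)‖ := by
    rw [← mul_sub, norm_mul, Complex.norm_real, Real.norm_of_nonneg hr]
  have h2 : |r - r'| ≤ ‖r * (u : ℂ) - r' * (v : ℂ)‖ := by
    have := abs_norm_sub_norm_le (r * (u : ℂ)) (r' * (v : ℂ))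
    simpa [Circle.norm_coe, abs_of_nonneg hr, abs_of_nonneg hr'] using this
  have h3 : ‖r' * (v : ℂ) - r * (v : ℂ)‖ = |r - r'| := by
    rw [← sub_mul, norm_mul, Circle.norm_coe, mul_one, ← Complex.ofReal_sub, Complex.norm_real,
      Real.norm_eq_abs, abs_sub_comm]
  have h4 := norm_add_le (r * (u : ℂ) - r' * (v : ℂ)) (r' * (v : ℂ) - r * (v : ℂ))
  rw [sub_add_sub_cancel] at h4
  linarith

/-- Coefficients with almost the same invariants are almost equal up to a shift. -/
theorem exists_forall_norm_sub_le (S : Finset ℕ) (hS : ∀ j ∈ S, 0 < j) {c c₀ : ℝ} (hc : 0 ≤ c)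
    (hc₀ : 0 < c₀) :
    ∃ C : ℝ, 0 ≤ C ∧ ∀ (a b : ℕ → ℂ) (δ : ℝ), 0 ≤ δ →
      (∀ j ∈ S, c₀ ≤ ‖a j‖) → (∀ j ∈ S, ‖a j‖ ≤ c) →
      (∀ j ∈ S, ‖a j ^ 1 * (starRingEnd ℂ (a j)) ^ 1 - b j ^ 1 * (starRingEnd ℂ (b j)) ^ 1‖ ≤ δ) →
      (∀ j ∈ S, ∀ k ∈ S, j ≠ k →
        ‖a j ^ (k / S.gcd id) * (starRingEnd ℂ (a k)) ^ (j / S.gcd id) -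
          b j ^ (k / S.gcd id) * (starRingEnd ℂ (b k)) ^ (j / S.gcd id)‖ ≤ δ) →
      ∃ z : Circle, ∀ j ∈ S, ‖a j - (z : ℂ) ^ j * b j‖ ≤ C * δ := by
  obtain ⟨N, hN, hw⟩ := exists_forall_norm_sub_pow_le S hS
  set d := S.gcd id
  -- Capping at 1 makes powers of m decrease, so m^(e + e) bounds all the moduli of monomials in a
  -- below, whatever their exponents.
  set m := min c₀ 1 with hm
  have hm0 : 0 < m := lt_min hc₀ one_pos
  set e := ∑ j ∈ S, j with he
  -- The first term is the modulus error, the second the phase error weighted by ‖a j‖ ≤ c.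
  refine ⟨1 / c₀ + c * (N * (2 / m ^ (e + e))), by positivity, fun a b δ hδ ha0 hac h2 h3 => ?_⟩
  choose A hA using fun j => exists_eq_norm_mul_circle (a j)
  choose B hB using fun j => exists_eq_norm_mul_circle (b j)
  obtain ⟨z, hz⟩ := hw (fun j => A j * (B j)⁻¹) (2 / m ^ (e + e) * δ) (by
    intro j hj k hk
    -- The diagonal relation is trivial. Omitting it from the hypotheses keeps the degrees of the
    -- invariants at most 2s − 1 instead of 2s.
    by_cases hjk : j = k
    · subst hjk
      simp only [mul_inv_cancel, Circle.coe_one, sub_self, norm_zero]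
      positivity
    set p := k / d
    set q := j / d
    set U : Circle := A j ^ p * (A k)⁻¹ ^ q with hU
    set V : Circle := B j ^ p * (B k)⁻¹ ^ q with hV
    have hX : ∀ (a : ℕ → ℂ) (A : ℕ → Circle), (∀ j, a j = ‖a j‖ * (A j : ℂ)) →
        a j ^ p * (starRingEnd ℂ (a k)) ^ q =
          ((‖a j‖ ^ p * ‖a k‖ ^ q : ℝ) : ℂ) * ((A j ^ p * (A k)⁻¹ ^ q : Circle) : ℂ) := by
      intro a A hA
      conv_lhs => rw [hA j, hA k]
      rw [map_mul, Complex.conj_ofReal, ← Circle.coe_inv_eq_conj]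
      push_cast
      ring
    have h4 := h3 j hj k hk hjk
    rw [hX a A hA, hX b B hB] at h4
    have h5 := mul_norm_circle_sub_le (r := ‖a j‖ ^ p * ‖a k‖ ^ q)
      (r' := ‖b j‖ ^ p * ‖b k‖ ^ q) (by positivity) (by positivity) U V
    have hexp : ∀ i ∈ S, i / d ≤ e := fun i hi => (Nat.div_le_self _ _).trans
      (Finset.single_le_sum (f := fun i => i) (fun _ _ => Nat.zero_le _) hi)
    have h6 : m ^ (e + e) ≤ ‖a j‖ ^ p * ‖a k‖ ^ q := by
      have h7 : ∀ i ∈ S, ∀ n ≤ e, m ^ e ≤ ‖a i‖ ^ n := fun i hi n hn =>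
        (pow_le_pow_of_le_one hm0.le (min_le_right _ _) hn).trans
          (pow_le_pow_left₀ hm0.le ((min_le_left _ _).trans (ha0 i hi)) _)
      rw [pow_add]
      exact mul_le_mul (h7 j hj p (hexp k hk)) (h7 k hk q (hexp j hj)) (by positivity)
        (by positivity)
    have h8 : ((A j * (B j)⁻¹) ^ p * ((A k * (B k)⁻¹) ^ q)⁻¹ : Circle) = U * V⁻¹ := by
      rw [hU, hV]
      simp only [mul_pow, mul_inv, inv_pow, inv_inv]
      rw [mul_mul_mul_comm]
    have h9 : ‖((U * V⁻¹ : Circle) : ℂ) - 1‖ = ‖(U : ℂ) - V‖ := by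
      have : (((U * V⁻¹ : Circle) : ℂ) - 1) * V = (U : ℂ) - V := by
        rw [sub_mul, ← Circle.coe_mul, inv_mul_cancel_right, one_mul]
      rw [← this, norm_mul, Circle.norm_coe, mul_one]
    rw [h8, h9, div_mul_eq_mul_div, le_div_iff₀ (by positivity), mul_comm]
    calc m ^ (e + e) * ‖(U : ℂ) - V‖ ≤ ‖a j‖ ^ p * ‖a k‖ ^ q * ‖(U : ℂ) - V‖ := by gcongr
      _ ≤ _ := h5.trans (by gcongr))
  refine ⟨z, fun j hj => ?_⟩
  -- Factor the difference of squares; the sum of the moduli is at least c₀.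
  have h4 : |‖a j‖ - ‖b j‖| ≤ 1 / c₀ * δ := by
    have h5 := h2 j hj
    rw [pow_one, pow_one, pow_one, pow_one, Complex.mul_conj, Complex.mul_conj,
      ← Complex.ofReal_sub, Complex.norm_real, Complex.normSq_eq_norm_sq,
      Complex.normSq_eq_norm_sq, Real.norm_eq_abs,
      show ‖a j‖ ^ 2 - ‖b j‖ ^ 2 = (‖a j‖ - ‖b j‖) * (‖a j‖ + ‖b j‖) by ring, abs_mul,
      abs_of_nonneg (by positivity : 0 ≤ ‖a j‖ + ‖b j‖)] at h5
    rw [div_mul_eq_mul_div, one_mul, le_div_iff₀ hc₀]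
    refine le_trans ?_ h5
    gcongr
    linarith [ha0 j hj, norm_nonneg (b j)]
  have h5 : a j - (z : ℂ) ^ j * b j = ((‖a j‖ - ‖b j‖ : ℝ) : ℂ) * ((z ^ j * B j : Circle) : ℂ) +
      ‖a j‖ * ((((A j * (B j)⁻¹ : Circle) : ℂ) - (z : ℂ) ^ j) * B j) := by
    have h6 : ((A j * (B j)⁻¹ : Circle) : ℂ) * B j = A j := by
      rw [← Circle.coe_mul, inv_mul_cancel_right]
    rw [sub_mul, h6]
    conv_lhs => rw [hA j, hB j]
    push_cast
    ring
  rw [h5, add_mul]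
  refine (norm_add_le _ _).trans (add_le_add ?_ ?_)
  · rw [norm_mul, Circle.norm_coe, mul_one, Complex.norm_real, Real.norm_eq_abs]
    exact h4
  · rw [norm_mul, norm_mul, Circle.norm_coe, mul_one, Complex.norm_real, norm_norm, mul_assoc,
      mul_assoc]
    exact mul_le_mul (hac j hj) (hz j hj) (norm_nonneg _) hc

end CircleRelations


/-! ### Assembling the lower bound. -/

section LowerBound

variable {L : ℕ}

/-- The sum of the individual constants dominates each of them. This gives uniformity over
exponents, frequencies, supports S and finally s. -/
theorem exists_forall_mem_of_monotone {ι : Type*} (T : Finset ι) {P : ι → ℝ → Prop}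
    (hP : ∀ i C C', C ≤ C' → P i C → P i C') (h : ∀ i ∈ T, ∃ C, 0 ≤ C ∧ P i C) :
    ∃ C, 0 ≤ C ∧ ∀ i ∈ T, P i C := by
  choose! C hC0 hC using h
  exact ⟨∑ i ∈ T, C i, Finset.sum_nonneg hC0, fun i hi =>
    hP i _ _ (Finset.single_le_sum hC0 hi) (hC i hi)⟩

theorem exists_forall_norm_invariant_sub_le (hL : Odd L) (K : ℝ) (n : ℕ) :
    ∃ M : ℝ, 0 ≤ M ∧ ∀ p q j k : ℕ, p + q ≤ n → j ≤ L / 2 → k ≤ L / 2 → p * j = q * k →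
      ∀ θ φ : EuclideanSpace ℝ (Fin L), ‖θ‖ ≤ K → ‖φ‖ ≤ K →
        ‖invariant p q j k θ - invariant p q j k φ‖ ≤ M * √(divergence 1 θ φ) := by
  obtain ⟨M, hM0, hM⟩ := exists_forall_mem_of_monotone
    ((Finset.range (n + 1) ×ˢ Finset.range (n + 1)) ×ˢ
      (Finset.range (L / 2 + 1) ×ˢ Finset.range (L / 2 + 1)))
    (P := fun i M => i.1.1 * i.2.1 = i.1.2 * i.2.2 →
      ∀ θ φ : EuclideanSpace ℝ (Fin L), ‖θ‖ ≤ K → ‖φ‖ ≤ K →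
        ‖invariant i.1.1 i.1.2 i.2.1 i.2.2 θ - invariant i.1.1 i.1.2 i.2.1 i.2.2 φ‖ ≤
          M * √(divergence 1 θ φ))
    (fun i C C' hCC' h hi θ φ hθ hφ => (h hi θ φ hθ hφ).trans (by gcongr))
    (fun i hi => by
      simp only [Finset.mem_product, Finset.mem_range] at hi
      by_cases hpq : i.1.1 * i.2.1 = i.1.2 * i.2.2
      · obtain ⟨C, hC0, hC⟩ := exists_norm_invariant_sub_le hL K (p := i.1.1) (q := i.1.2)
          (j := i.2.1) (k := i.2.2) (by omega) (by omega) hpq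
        exact ⟨C, hC0, fun _ => hC⟩
      · exact ⟨0, le_rfl, fun h => absurd h hpq⟩)
  refine ⟨M, hM0, fun p q j k hpq hj hk h => hM ((p, q), (j, k)) ?_ h⟩
  simp only [Finset.mem_product, Finset.mem_range]
  omega

/-- σ may be below 1, but cσ ≥ 1, so lower powers are absorbed by σ^n at the cost of c^n. -/
theorem pow_le_pow_mul_pow {c σ : ℝ} (hc : 1 ≤ c) (hσ : c⁻¹ ≤ σ) {m n : ℕ} (hmn : m ≤ n) :
    σ ^ m ≤ c ^ n * σ ^ n := by
  have hc0 : 0 < c := one_pos.trans_le hc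
  have hσ0 : 0 < σ := (inv_pos.2 hc0).trans_le hσ
  have h1 : 1 ≤ c * σ := by
    calc 1 = c * c⁻¹ := (mul_inv_cancel₀ hc0.ne').symm
      _ ≤ c * σ := by gcongr
  calc σ ^ m ≤ c ^ m * σ ^ m := le_mul_of_one_le_left (by positivity) (one_le_pow₀ hc)
    _ = (c * σ) ^ m := (mul_pow _ _ _).symm
    _ ≤ (c * σ) ^ n := pow_le_pow_right₀ h1 hmn
    _ = c ^ n * σ ^ n := mul_pow _ _ _

/-- Invariants are homogeneous of degree p + q, so passing from unit noise to noise σ costs σ^(p+q),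
hence at most a multiple of σ^n. -/
theorem exists_forall_norm_invariant_sub_le_pow (hL : Odd L) {c : ℝ} (hc : 1 ≤ c) (K : ℝ) (n : ℕ) :
    ∃ M : ℝ, 0 ≤ M ∧ ∀ p q j k : ℕ, p + q ≤ n → j ≤ L / 2 → k ≤ L / 2 → p * j = q * k →
      ∀ (θ φ : EuclideanSpace ℝ (Fin L)) (σ : ℝ), c⁻¹ ≤ σ → ‖θ‖ ≤ K * σ → ‖φ‖ ≤ K * σ →
        ‖invariant p q j k θ - invariant p q j k φ‖ ≤ M * (σ ^ n * √(divergence σ θ φ)) := by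
  obtain ⟨M, hM0, hM⟩ := exists_forall_norm_invariant_sub_le hL K n
  refine ⟨c ^ n * M, by positivity, fun p q j k hpq hj hk h θ φ σ hσ hθ hφ => ?_⟩
  have hσ0 : 0 < σ := (inv_pos.2 (one_pos.trans_le hc)).trans_le hσ
  have hnorm : ∀ θ : EuclideanSpace ℝ (Fin L), ‖θ‖ ≤ K * σ → ‖σ⁻¹ • θ‖ ≤ K := by
    intro θ hθ
    rw [norm_smul, norm_inv, Real.norm_of_nonneg hσ0.le, inv_mul_le_iff₀ hσ0]
    linarith
  have hinv : ∀ θ : EuclideanSpace ℝ (Fin L),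
      invariant p q j k θ = ((σ ^ (p + q) : ℝ) : ℂ) * invariant p q j k (σ⁻¹ • θ) := by
    intro θ
    have := invariant_smul p q j k σ (σ⁻¹ • θ)
    rw [smul_inv_smul₀ hσ0.ne'] at this
    rw [this, Complex.ofReal_pow]
  rw [hinv θ, hinv φ, ← mul_sub, norm_mul, Complex.norm_real,
    Real.norm_of_nonneg (by positivity), divergence_eq_divergence_one hL hσ0.ne']
  calc σ ^ (p + q) * ‖invariant p q j k (σ⁻¹ • θ) - invariant p q j k (σ⁻¹ • φ)‖
      ≤ (c ^ n * σ ^ n) * (M * √(divergence 1 (σ⁻¹ • θ) (σ⁻¹ • φ))) :=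
        mul_le_mul (pow_le_pow_mul_pow hc hσ hpq)
          (hM p q j k hpq hj hk h _ _ (hnorm θ hθ) (hnorm φ hφ)) (norm_nonneg _) (by positivity)
    _ = _ := by ring

/-- The orbit distance is controlled by the differences of the invariants. -/
theorem exists_forall_orbitDist_le (hL : Odd L) {c c₀ : ℝ} (hc : 0 ≤ c) (hc₀ : 0 < c₀) :
    ∃ C : ℝ, 0 ≤ C ∧ ∀ S ∈ (Finset.Icc 1 (L / 2)).powerset,
      ∀ (θ φ : EuclideanSpace ℝ (Fin L)) (δ : ℝ), 0 ≤ δ → posSupp θ = S → ‖θ‖ ≤ c →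
        (∀ j ∈ posSupp θ, c₀ ≤ ‖dft θ j‖) → φ ∈ Set.range (suppProj (posSupp θ)) →
        ‖invariant 1 0 0 0 θ - invariant 1 0 0 0 φ‖ ≤ δ →
        (∀ j ∈ S, ‖invariant 1 1 j j θ - invariant 1 1 j j φ‖ ≤ δ) →
        (∀ j ∈ S, ∀ k ∈ S, j ≠ k →
          ‖invariant (k / S.gcd id) (j / S.gcd id) j k θ -
            invariant (k / S.gcd id) (j / S.gcd id) j k φ‖ ≤ δ) →
        orbitDist θ φ ≤ C * δ := by
  refine exists_forall_mem_of_monotone _ (fun S C C' hCC' h θ φ δ hδ h1 h2 h3 h4 h5 h6 h7 =>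
    (h θ φ δ hδ h1 h2 h3 h4 h5 h6 h7).trans (by gcongr)) fun S hS => ?_
  rw [Finset.mem_powerset] at hS
  obtain ⟨C, hC0, hC⟩ := exists_forall_norm_sub_le S (fun j hj => (Finset.mem_Icc.1 (hS hj)).1)
    hc hc₀
  -- Each frequency contributes at most (1 + C)δ: δ at frequency 0, Cδ on ±S, and nothing elsewhere,
  -- where both signals vanish.
  refine ⟨(Finset.Icc (-((L / 2 : ℕ) : ℤ)) ((L / 2 : ℕ) : ℤ)).card * (1 + C), by positivity, ?_⟩
  rintro θ φ δ hδ hθS hθ hθ0 ⟨φ₀, rfl⟩ h0 h1 h2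
  set φ := suppProj (posSupp θ) φ₀ with hφ
  have hle : ∀ j ∈ S, j ≤ L / 2 := fun j hj => (Finset.mem_Icc.1 (hS hj)).2
  obtain ⟨z, hz⟩ := hC (fun j => dft θ j) (fun j => dft φ j) δ hδ
    (fun j hj => hθ0 j (hθS ▸ hj))
    (fun j hj => (norm_dft_le hL θ (by rw [Nat.abs_cast]; exact_mod_cast hle j hj)).trans hθ)
    h1 h2
  refine (orbitDist_le θ φ z).trans ((norm_le_sum_dft hL _).trans ?_)
  rw [mul_assoc, ← nsmul_eq_mul]
  refine Finset.sum_le_card_nsmul _ _ _ fun j hj => ?_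
  have hpos : ∀ j : ℕ, j ≤ L / 2 → ‖dft (θ - phaseShift z φ) j‖ ≤ (1 + C) * δ := by
    intro j hj
    have hj' : |(j : ℤ)| ≤ ((L / 2 : ℕ) : ℤ) := by rw [Nat.abs_cast]; exact_mod_cast hj
    rw [dft_sub, dft_phaseShift hL _ _ _ hj']
    obtain rfl | hj0 := Nat.eq_zero_or_pos j
    · simp only [invariant, pow_one, pow_zero, mul_one] at h0
      simp only [Nat.cast_zero, zpow_zero, one_mul] at h0 ⊢
      nlinarith [mul_nonneg hC0 hδ]
    by_cases hjS : j ∈ S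
    · have := hz j hjS
      rw [zpow_natCast]
      nlinarith
    · have hjθ : j ∉ posSupp θ := by rw [hθS]; exact_mod_cast hjS
      have a1 : dft θ j = 0 := by
        by_contra h
        exact hjθ ⟨hj0, hj, h⟩
      have a2 : dft φ j = 0 := by
        rw [hφ, dft_suppProj hL _ _ _ hj', if_neg]
        simp only [Nat.cast_eq_zero, Int.natAbs_natCast, not_or]
        exact ⟨hj0.ne', hjθ⟩
      rw [a1, a2, mul_zero, sub_zero, norm_zero]
      positivity
  rw [Finset.mem_Icc] at hj
  have h3 := hpos j.natAbs (by omega)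
  obtain h | h := Int.natAbs_eq j
  · rwa [← h] at h3
  · rw [h, dft_neg, RCLike.norm_conj]
    exact h3

theorem exists_sq_orbitDist_le (hL : Odd L) {c c₀ : ℝ} (hc : 1 < c) (hc₀ : 0 < c₀) {s : ℕ}
    (hs : 2 ≤ s) (hsL : s ≤ L / 2) :
    ∃ B : ℝ, 0 ≤ B ∧ ∀ θ ∈ signalClass L c c₀ s, ∀ φ ∈ Set.range (suppProj (posSupp θ)),
      ∀ σ : ℝ, ‖θ‖ ≤ σ →
        orbitDist θ φ ^ 2 ≤ B * ((σ ^ (2 * s - 1)) ^ 2 * divergence σ θ φ) := by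
  have hc0 : 0 < c := one_pos.trans hc
  set n := 2 * s - 1 with hn
  obtain ⟨K₀, hK₀, hlarge⟩ := exists_forall_sq_norm_le_divergence hL
  set K := max K₀ 1 with hK
  obtain ⟨M, hM0, hM⟩ := exists_forall_norm_invariant_sub_le_pow hL hc.le K n
  obtain ⟨C, hC0, hC⟩ := exists_forall_orbitDist_le hL hc0.le hc₀
  -- The first summand serves large φ, the second the moment argument for ‖φ‖ ≤ Kσ.
  refine ⟨16 * (c ^ n) ^ 2 + (C * M) ^ 2, by positivity, ?_⟩
  rintro θ ⟨hθ1, hθ2, hθ3, hθ4⟩ φ hφ σ hσ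
  have hσc : c⁻¹ ≤ σ := hθ1.trans hσ
  have hσ0 : 0 < σ := (inv_pos.2 hc0).trans_le hσc
  have hD : 0 ≤ divergence σ θ φ := ENNReal.toReal_nonneg
  have hρ := orbitDist_nonneg θ φ
  obtain hφK | hφK := le_total (K * σ) ‖φ‖
  · have h1 : ‖σ⁻¹ • θ‖ ≤ 1 := by
      rw [norm_smul, norm_inv, Real.norm_of_nonneg hσ0.le, inv_mul_le_iff₀ hσ0]
      linarith
    have hφn : ‖σ⁻¹ • φ‖ = σ⁻¹ * ‖φ‖ := by
      rw [norm_smul, norm_inv, Real.norm_of_nonneg hσ0.le]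
    have h2 : K₀ ≤ ‖σ⁻¹ • φ‖ := by
      rw [hφn, le_inv_mul_iff₀ hσ0]
      refine le_trans ?_ hφK
      rw [mul_comm]
      gcongr
      exact le_max_left _ _
    have h3 := hlarge _ _ h1 h2
    rw [← divergence_eq_divergence_one hL hσ0.ne', hφn, mul_pow, inv_pow,
      inv_mul_le_iff₀ (by positivity)] at h3
    have h4 : σ ≤ ‖φ‖ := by
      refine le_trans ?_ hφK
      exact le_mul_of_one_le_left hσ0.le (le_max_right _ _)
    have h5 : orbitDist θ φ ≤ 2 * ‖φ‖ := by
      refine (orbitDist_le θ φ 1).trans ((norm_sub_le _ _).trans ?_)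
      rw [norm_phaseShift hL]
      linarith
    have h6 : σ ^ 2 ≤ (c ^ n * σ ^ n) ^ 2 := by
      have := pow_le_pow_mul_pow hc.le hσc (m := 1) (n := n) (by omega)
      rw [pow_one] at this
      gcongr
    calc orbitDist θ φ ^ 2 ≤ (2 * ‖φ‖) ^ 2 := by gcongr
      _ = 4 * ‖φ‖ ^ 2 := by ring
      _ ≤ 4 * (σ ^ 2 * (4 * divergence σ θ φ)) := by gcongr
      _ = 16 * (σ ^ 2 * divergence σ θ φ) := by ring
      _ ≤ 16 * ((c ^ n * σ ^ n) ^ 2 * divergence σ θ φ) := by gcongr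
      _ = 16 * (c ^ n) ^ 2 * ((σ ^ n) ^ 2 * divergence σ θ φ) := by ring
      _ ≤ _ := by
        gcongr
        exact le_add_of_nonneg_right (by positivity)
  · classical
    set S : Finset ℕ := (Finset.Icc 1 (L / 2)).filter (· ∈ posSupp θ) with hS
    have hSθ : posSupp θ = S := by
      ext j
      simp only [hS, Finset.coe_filter, Finset.mem_Icc, Set.mem_ofPred_eq]
      exact ⟨fun h => ⟨⟨h.1, h.2.1⟩, h⟩, fun h => h.2⟩
    have hSs : ∀ j ∈ S, 1 ≤ j ∧ j ≤ s := fun j hj => by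
      have := hθ4 (hSθ ▸ Finset.mem_coe.2 hj : j ∈ posSupp θ)
      exact this
    have hθK : ‖θ‖ ≤ K * σ := hσ.trans (le_mul_of_one_le_left hσ0.le (le_max_right _ _))
    have h1 := hC S (by simp [hS]) θ φ (M * (σ ^ n * √(divergence σ θ φ))) (by positivity) hSθ
      hθ2 hθ3 hφ
      -- The mean has degree 1 and the squared moduli degree 2; the latter fits under n = 2s − 1
      -- because s ≥ 2.
      (hM 1 0 0 0 (by omega) (by omega) (by omega) rfl θ φ σ hσc hθK hφK)
      (fun j hj => hM 1 1 j j (by omega) (by have := hSs j hj; omega)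
        (by have := hSs j hj; omega) rfl θ φ σ hσc hθK hφK)
      -- Distinct j, k ≤ s satisfy j/d + k/d ≤ j + k ≤ 2s − 1; this is the source of the exponent in
      -- the theorem.
      (fun j hj k hk hjk => by
        have a1 := hSs j hj
        have a2 := hSs k hk
        have a3 := Nat.div_le_self k (S.gcd id)
        have a4 := Nat.div_le_self j (S.gcd id)
        refine hM _ _ j k (by omega) (by omega) (by omega) ?_ θ φ σ hσc hθK hφK
        obtain ⟨j', hj'⟩ : S.gcd id ∣ j := Finset.gcd_dvd (f := id) hj
        obtain ⟨k', hk'⟩ : S.gcd id ∣ k := Finset.gcd_dvd (f := id) hk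
        have hd : 0 < S.gcd id := Nat.pos_of_ne_zero fun h => by
          rw [h, zero_mul] at hj'; omega
        generalize S.gcd id = d at *
        subst hj' hk'
        rw [Nat.mul_div_cancel_left _ hd, Nat.mul_div_cancel_left _ hd]
        ring)
    calc orbitDist θ φ ^ 2 ≤ (C * (M * (σ ^ n * √(divergence σ θ φ)))) ^ 2 := by gcongr
      _ = (C * M) ^ 2 * ((σ ^ n) ^ 2 * √(divergence σ θ φ) ^ 2) := by ring
      _ = (C * M) ^ 2 * ((σ ^ n) ^ 2 * divergence σ θ φ) := by rw [Real.sq_sqrt hD]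
      _ ≤ _ := by
        gcongr
        exact le_add_of_nonneg_left (by positivity)

end LowerBound

end PhaseShift

end

theorem mainTheorem5 (L : ℕ) (hL : Odd L) (c c₀ : ℝ) (hc : 1 < c) (hc₀ : 0 < c₀) :
    ∃ C : ℝ, 0 < C ∧
      ∀ s : ℕ, 2 ≤ s → s ≤ L / 2 →
      ∀ θ ∈ PhaseShift.signalClass L c c₀ s,
      ∀ φ ∈ Set.range
        (PhaseShift.suppProj (L := L) (PhaseShift.posSupp θ)),
      ∀ σ : ℝ, ‖θ‖ ≤ σ →
        C * σ ^ (-4 * (s : ℤ) + 2) * PhaseShift.orbitDist θ φ ^ 2 ≤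
          PhaseShift.divergence σ θ φ := by
  obtain ⟨B, hB0, hB⟩ := PhaseShift.exists_forall_mem_of_monotone (Finset.Icc 2 (L / 2))
    (P := fun s B => ∀ θ ∈ PhaseShift.signalClass L c c₀ s,
      ∀ φ ∈ Set.range (PhaseShift.suppProj (L := L) (PhaseShift.posSupp θ)), ∀ σ : ℝ, ‖θ‖ ≤ σ →
        PhaseShift.orbitDist θ φ ^ 2 ≤
          B * ((σ ^ (2 * s - 1)) ^ 2 * PhaseShift.divergence σ θ φ))
    (fun s B B' hBB' h θ hθ φ hφ σ hσ => (h θ hθ φ hφ σ hσ).trans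
      (mul_le_mul_of_nonneg_right hBB' (mul_nonneg (sq_nonneg _) ENNReal.toReal_nonneg)))
    (fun s hs => PhaseShift.exists_sq_orbitDist_le hL hc hc₀ (Finset.mem_Icc.1 hs).1
      (Finset.mem_Icc.1 hs).2)
  -- B may be 0, hence B + 1 in the denominator.
  refine ⟨1 / (B + 1), by positivity, fun s hs hsL θ hθ φ hφ σ hσ => ?_⟩
  have h1 := hB s (Finset.mem_Icc.2 ⟨hs, hsL⟩) θ hθ φ hφ σ hσ
  have hσ0 : 0 < σ := (inv_pos.2 (one_pos.trans hc)).trans_le (hθ.1.trans hσ)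
  have hD : 0 ≤ PhaseShift.divergence σ θ φ := ENNReal.toReal_nonneg
  have h2 : σ ^ (-4 * (s : ℤ) + 2) = ((σ ^ (2 * s - 1)) ^ 2)⁻¹ := by
    rw [← pow_mul, ← zpow_natCast, ← zpow_neg]
    congr 1
    have : 1 ≤ 2 * s := by omega
    push_cast [Nat.cast_sub this]
    ring
  have hpos : 0 < (σ ^ (2 * s - 1)) ^ 2 := by positivity
  rw [h2, one_div, mul_assoc, inv_mul_le_iff₀ (by positivity), inv_mul_le_iff₀ hpos]
  refine h1.trans ?_
  have := mul_nonneg hpos.le hD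
  nlinarith
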